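/- Let $k$ be an algebraically closed field and let $\mathcal C$ be a modular tensor category over $k$, i.e. a ribbon fusion category over $k$ with braiding $\beta$ and duals $X^\vee$ whose S-matrix is invertible. Let $\mathcal I$ be a complete set of simple objects of $\mathcal C$. Write $\operatorname{tr}$ for the quantum trace, $d(X)=\operatorname{tr}(\mathrm{id}_X)$, $d(\mathcal C)=\sum_{T\in\mathcal I}d(T)^2$ and $\mathcal S_{X,Y}=\operatorname{tr}(\beta_{Y,X}\circ\beta_{X,Y})$ (the Hopf link). The tube category $\mathcal{TC}$ has the objects of $\mathcal C$ as objects and $\operatorname{Hom}_{\mathcal{TC}}(X,Y)=\int^{G\in\mathcal C}\operatorname{Hom}_{\mathcal C}(G\otimes X,Y\otimes G)\ \bigl(\cong\bigoplus_{T\in\mathcal I}\operatorname{Hom}_{\mathcal C}(T\otimes X,Y\otimes T)\bigr)$; write $[G,f]$ for the class of $f\colon G\otimes X\to Y\otimes G$. Composition is stacking: $[H,g]\circ[G,f]=[H\otimes G,(g\otimes \mathrm{id}_G)\circ(\mathrm{id}_H\otimes f)]$ for $f\colon G\otimes X\to Y\otimes G$ and $g\colon H\otimes Y\to Z\otimes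 H$. For $T,X,Y$ in $\mathcal C$ let $h_T^{X,Y}=(\mathrm{id}_X\otimes\beta_{Y,T}^{-1})\circ(\beta_{T,X}\otimes \mathrm{id}_Y)\colon T\otimes X\otimes Y\to X\otimes Y\otimes T$ (the strand $T$ passes over $X$ and under $Y$). Define $$\epsilon_X^Y=\frac1{d(\mathcal C)}\sum_{T\in\mathcal I}d(T)\,[T,h_T^{X,Y}]\in\operatorname{End}_{\mathcal{TC}}(X\otimes Y).$$ For $I,J,S\in\mathcal I$ let $\gamma^S_{IJ}\in\operatorname{End}_{\mathcal{TC}}(S)$ be the annular morphism in which the strands $J^\vee$ and $I^\vee$ run around the cylinder, $J^\vee$ over and $I^\vee$ under the strand $S$: $$\gamma^S_{IJ}=\bigl[J^\vee\otimes I^\vee,\ (\beta_{J^\vee,S}\otimes \mathrm{id}_{I^\vee})\circ(\mathrm{id}_{J^\vee}\otimes\beta_{S,I^\vee}^{-1})\bigr].$$ Then, for all $S,A,B\in\mathcal I$, the pairing $b\otimes b'\mapsto\operatorname{tr}(b'\circ b)$ of $\operatorname{Hom}_{\mathcal C}(S,A\otimes B)$ with $\operatorname{Hom}_{\mathcal C}(A\otimes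 B,S)$ is perfect. For any basis $(b)$ of $\operatorname{Hom}_{\mathcal C}(S,A\otimes B)$ with dual basis $(b^*)$ put $$\epsilon(S,A,B)=\frac{d(A)d(B)}{d(\mathcal C)}\sum_{T\in\mathcal I}\sum_b d(T)\,\bigl[T,\ (b^*\otimes \mathrm{id}_T)\circ h_T^{A,B}\circ(\mathrm{id}_T\otimes b)\bigr]\in\operatorname{End}_{\mathcal{TC}}(S).$$ Then for all $I,J,S\in\mathcal I$ $$\gamma^S_{IJ}=\sum_{A,B\in\mathcal I}\frac{\mathcal S_{I,A}\,\mathcal S_{B,J^\vee}}{d(A)\,d(B)}\ \epsilon(S,A,B).$$ Moreover, for all $A,B,S\in\mathcal I$, $\epsilon_A^B$ is an idempotent, the object $\langle A,B\rangle=(A\otimes B,\epsilon_A^B)$ of the idempotent completion of $\mathcal{TC}$ is simple, and $\epsilon(S,A,B)$ is the idempotent projecting $S$ onto its $\langle A,B\rangle$-isotypic component: its image is a finite direct sum of copies of $\langle A,B\rangle$, and every morphism $\langle A,B\rangle\to S$ or $S\to\langle A,B\rangle$ in the idempotent completion factors through it. -/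

import Mathlib

open CategoryTheory MonoidalCategory

noncomputable section

universe w v u

set_option linter.unusedSectionVars false

namespace TubeS

/-! ### Ribbon fusion categories and modular tensor categories -/

/-- The ribbon structure (twist) on a rigid braided monoidal category `C`. -/
class RibbonCategory (C : Type u) [Category.{v} C] [MonoidalCategory C] [BraidedCategory C]
    [RightRigidCategory C] where
  /-- the twist, a natural automorphism of the identity functor -/
  twist : 𝟭 C ≅ 𝟭 C
  /-- compatibility with the tensor product: the balancing axiom -/
  twist_tensor : ∀ X Y : C, twist.hom.app (X ⊗ Y) =
    (twist.hom.app X ⊗ₘ twist.hom.app Y) ≫ (β_ X Y).hom ≫ (β_ Y X).hom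
  /-- compatibility with duality -/
  twist_dual : ∀ X : C,
    (rightAdjointMate (twist.hom.app X) : Xᘁ ⟶ Xᘁ) = twist.hom.app Xᘁ

/-- A family `s` of objects is a complete set of simples: every `s i` is simple, distinct indices
give non-isomorphic objects, and every simple object is isomorphic to some `s i`. -/
structure IsCompleteSetOfSimples {C : Type u} [Category.{v} C] [Preadditive C] {ι : Type w}
    (s : ι → C) : Prop where
  simple : ∀ i, Simple (s i)
  eq_of_iso : ∀ i j, Nonempty (s i ≅ s j) → i = j
  exists_iso : ∀ X : C, Simple X → ∃ i, Nonempty (X ≅ s i)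

/-- A rigid `k`-linear abelian monoidal category is a fusion category over `k` if morphism spaces
are finite dimensional, the tensor unit is simple, there are finitely many simple objects up to
isomorphism, and every object is a finite direct sum of simple objects. -/
class FusionCategory (k : Type w) [Field k] (C : Type u) [Category.{v} C] [Abelian C] [Linear k C]
    [MonoidalCategory C] [MonoidalPreadditive C] [MonoidalLinear k C]
    [RightRigidCategory C] : Prop where
  finiteDimensional_hom : ∀ X Y : C, FiniteDimensional k (X ⟶ Y)
  simple_unit : Simple (𝟙_ C)
  exists_simples : ∃ (n : ℕ) (s : Fin n → C), IsCompleteSetOfSimples s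
  semisimple : ∀ X : C, ∃ (n : ℕ) (Y : Fin n → C) (p : ∀ a, X ⟶ Y a) (i : ∀ a, Y a ⟶ X),
    (∀ a, Simple (Y a)) ∧ (∀ a, i a ≫ p a = 𝟙 (Y a)) ∧ (∀ a b, a ≠ b → i a ≫ p b = 0) ∧
      ∑ a, p a ≫ i a = 𝟙 X

/-! ### Traces, dimensions and the S-matrix -/

section Unit

/-- The scalar `c` with `f = c • 𝟙`, for an endomorphism `f` of the tensor unit. -/
def unitScalar (k : Type w) [Field k] [IsAlgClosed k] {C : Type u} [Category.{v} C] [Abelian C]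
    [Linear k C] [MonoidalCategory C] [MonoidalPreadditive C] [MonoidalLinear k C]
    [RightRigidCategory C] [FusionCategory k C] (f : 𝟙_ C ⟶ 𝟙_ C) : k :=
  have := FusionCategory.finiteDimensional_hom (k := k) (𝟙_ C) (𝟙_ C)
  have := FusionCategory.simple_unit (k := k) (C := C)
  (endomorphism_simple_eq_smul_id k f).choose

variable (k : Type w) [Field k] [IsAlgClosed k] {C : Type u} [Category.{v} C] [Abelian C]
  [Linear k C] [MonoidalCategory C] [MonoidalPreadditive C] [MonoidalLinear k C]
  [RightRigidCategory C] [FusionCategory k C]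

theorem unitScalar_smul (f : 𝟙_ C ⟶ 𝟙_ C) : unitScalar k f • 𝟙 (𝟙_ C) = f :=
  have := FusionCategory.finiteDimensional_hom (k := k) (𝟙_ C) (𝟙_ C)
  have := FusionCategory.simple_unit (k := k) (C := C)
  (endomorphism_simple_eq_smul_id k f).choose_spec

theorem unitScalar_eq (f : 𝟙_ C ⟶ 𝟙_ C) (c : k) (h : c • 𝟙 (𝟙_ C) = f) : unitScalar k f = c := by
  have := FusionCategory.simple_unit (k := k) (C := C)
  have h1 : unitScalar k f • 𝟙 (𝟙_ C) = c • 𝟙 (𝟙_ C) := by rw [unitScalar_smul, h]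
  rw [← sub_eq_zero, ← sub_smul] at h1
  rcases smul_eq_zero.mp h1 with h2 | h2
  · exact sub_eq_zero.mp h2
  · exact absurd h2 (id_nonzero _)

theorem unitScalar_add (f g : 𝟙_ C ⟶ 𝟙_ C) :
    unitScalar k (f + g) = unitScalar k f + unitScalar k g :=
  unitScalar_eq k _ _ (by rw [add_smul, unitScalar_smul, unitScalar_smul])

theorem unitScalar_smul_left (c : k) (f : 𝟙_ C ⟶ 𝟙_ C) :
    unitScalar k (c • f) = c * unitScalar k f :=
  unitScalar_eq k _ _ (by rw [mul_smul, unitScalar_smul])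

end Unit

section Traces

variable (k : Type w) [Field k] [IsAlgClosed k] {C : Type u} [Category.{v} C] [Abelian C]
  [Linear k C] [MonoidalCategory C] [MonoidalPreadditive C] [MonoidalLinear k C]
  [BraidedCategory C] [RightRigidCategory C] [RibbonCategory C] [FusionCategory k C]

/-- The quantum trace of an endomorphism in a ribbon category:
`1 ⟶ X ⊗ X^∨ ⟶ X ⊗ X^∨ ⟶ X^∨ ⊗ X ⟶ 1`, the middle maps being `(f ≫ θ_X) ⊗ id` and the
braiding. -/
def qtr {X : C} (f : X ⟶ X) : k :=
  unitScalar k (η_ X Xᘁ ≫ (f ≫ (RibbonCategory.twist (C := C)).hom.app X) ▷ Xᘁ ≫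
    (β_ X Xᘁ).hom ≫ ε_ X Xᘁ)

/-- The quantum dimension `d(X)`. -/
def qdim (X : C) : k := qtr k (𝟙 X)

/-- The entry of the S-matrix at a pair of objects: the Hopf link, i.e. the trace of the double
braiding of `X` and `Y`. -/
def sEntry (X Y : C) : k := qtr k ((β_ X Y).hom ≫ (β_ Y X).hom)

/-- The dimension `d(C)` of the category, computed from a complete set of simples. -/
def globalDim {ι : Type*} [Fintype ι] (s : ι → C) : k := ∑ i, qdim k (s i) ^ 2

/-- The pairing `b ⊗ b' ↦ tr(b' ∘ b)` between `Hom(X, Y)` and `Hom(Y, X)`. -/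
def tracePairing (X Y : C) : (X ⟶ Y) →ₗ[k] (Y ⟶ X) →ₗ[k] k :=
  LinearMap.mk₂ k (fun f g => qtr k (f ≫ g))
    (fun f f' g => by
      simp only [qtr, Preadditive.add_comp, Preadditive.comp_add,
        MonoidalPreadditive.add_whiskerRight, unitScalar_add])
    (fun c f g => by
      simp only [qtr, Linear.smul_comp, Linear.comp_smul, MonoidalLinear.smul_whiskerRight,
        unitScalar_smul_left, smul_eq_mul])
    (fun f g g' => by
      simp only [qtr, Preadditive.add_comp, Preadditive.comp_add,
        MonoidalPreadditive.add_whiskerRight, unitScalar_add])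
    (fun c f g => by
      simp only [qtr, Linear.smul_comp, Linear.comp_smul, MonoidalLinear.smul_whiskerRight,
        unitScalar_smul_left, smul_eq_mul])

end Traces

/-- A modular tensor category over `k`: a ribbon fusion category over `k` whose S-matrix is
invertible. -/
class ModularTensorCategory (k : Type w) [Field k] [IsAlgClosed k] (C : Type u) [Category.{v} C]
    [Abelian C] [Linear k C] [MonoidalCategory C] [MonoidalPreadditive C] [MonoidalLinear k C]
    [BraidedCategory C] [RightRigidCategory C] [RibbonCategory C] : Prop
    extends FusionCategory k C where
  isUnit_det_sMatrix : ∀ (n : ℕ) (s : Fin n → C), IsCompleteSetOfSimples s →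
    IsUnit (Matrix.of fun i j => sEntry k (s i) (s j)).det

/-! ### The tube category -/

section Tube

variable (k : Type w) [Field k] {C : Type u} [Category.{v} C] [Preadditive C]
  [Linear k C] [MonoidalCategory C] [MonoidalPreadditive C] [MonoidalLinear k C]

/-- Formal linear combinations of annular diagrams from `X` to `Y`: a diagram is a morphism
`f : G ⊗ X ⟶ Y ⊗ G` of `C` drawn on the cylinder, the strand `G` running around it. -/
abbrev AnnularDiagrams (X Y : C) : Type (max u v) :=
  DirectSum C fun G => (G ⊗ X ⟶ Y ⊗ G)

open Classical in
/-- The diagram given by `f`. -/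
def diagram {X Y : C} (G : C) : (G ⊗ X ⟶ Y ⊗ G) →ₗ[k] AnnularDiagrams X Y :=
  DirectSum.lof k C (fun G => (G ⊗ X ⟶ Y ⊗ G)) G

/-- Sliding a morphism `u` on the strand around the cylinder does not change the annular
morphism. -/
def slideRelations (X Y : C) : Submodule k (AnnularDiagrams X Y) :=
  Submodule.span k {z | ∃ (G H : C) (u : G ⟶ H) (f : H ⊗ X ⟶ Y ⊗ G),
    z = diagram k G (u ▷ X ≫ f) - diagram k H (f ≫ Y ◁ u)}

/-- Morphisms of the tube category: the coend `∫^G Hom(G ⊗ X, Y ⊗ G)`. -/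
abbrev TubeHom (X Y : C) : Type (max u v) := AnnularDiagrams X Y ⧸ slideRelations k X Y

/-- The annular morphism given by `f : G ⊗ X ⟶ Y ⊗ G`. -/
def tubeMk {X Y : C} (G : C) : (G ⊗ X ⟶ Y ⊗ G) →ₗ[k] TubeHom k X Y :=
  (slideRelations k X Y).mkQ ∘ₗ diagram k G

variable {k}

theorem tubeMk_slide {X Y G H : C} (u : G ⟶ H) (f : H ⊗ X ⟶ Y ⊗ G) :
    tubeMk k G (u ▷ X ≫ f) = tubeMk k H (f ≫ Y ◁ u) :=
  (Submodule.Quotient.eq _).mpr (Submodule.subset_span ⟨G, H, u, f, rfl⟩)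

/-- Linear maps out of the coend. -/
def tubeLift {X Y : C} {M : Type*} [AddCommGroup M] [Module k M]
    (φ : ∀ G : C, (G ⊗ X ⟶ Y ⊗ G) →ₗ[k] M)
    (h : ∀ (G H : C) (u : G ⟶ H) (f : H ⊗ X ⟶ Y ⊗ G), φ G (u ▷ X ≫ f) = φ H (f ≫ Y ◁ u)) :
    TubeHom k X Y →ₗ[k] M := by
  classical
  refine (slideRelations k X Y).liftQ (DirectSum.toModule k C M φ) ?_
  rw [slideRelations, Submodule.span_le]
  rintro _ ⟨G, H, u, f, rfl⟩
  simp only [SetLike.mem_coe, LinearMap.mem_ker, map_sub, sub_eq_zero, diagram]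
  convert! h G H u f using 1
  · exact DirectSum.toModule_lof k (φ := φ) G _
  · exact DirectSum.toModule_lof k (φ := φ) H _

theorem tubeLift_mk {X Y : C} {M : Type*} [AddCommGroup M] [Module k M]
    (φ : ∀ G : C, (G ⊗ X ⟶ Y ⊗ G) →ₗ[k] M)
    (h : ∀ (G H : C) (u : G ⟶ H) (f : H ⊗ X ⟶ Y ⊗ G), φ G (u ▷ X ≫ f) = φ H (f ≫ Y ◁ u))
    (G : C) (f : G ⊗ X ⟶ Y ⊗ G) : tubeLift φ h (tubeMk k G f) = φ G f := by
  classical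
  exact DirectSum.toModule_lof k (φ := φ) G f

theorem tubeHom_ext {X Y : C} {M : Type*} [AddCommGroup M] [Module k M]
    {a b : TubeHom k X Y →ₗ[k] M}
    (h : ∀ (G : C) (f : G ⊗ X ⟶ Y ⊗ G), a (tubeMk k G f) = b (tubeMk k G f)) : a = b := by
  classical
  refine Submodule.linearMap_qext _ (DirectSum.linearMap_ext k fun G => ?_)
  ext f
  exact h G f

/-- Stacking of annular diagrams: first `f`, then `g`, the strand of `g` to the left. -/
def stack {X Y Z : C} (G H : C) (f : G ⊗ X ⟶ Y ⊗ G) (g : H ⊗ Y ⟶ Z ⊗ H) :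
    (H ⊗ G) ⊗ X ⟶ Z ⊗ (H ⊗ G) :=
  (α_ H G X).hom ≫ H ◁ f ≫ (α_ H Y G).inv ≫ g ▷ G ≫ (α_ Z H G).hom

variable (k) in
/-- Stacking of annular diagrams as a bilinear map. -/
def stackₗ {X Y Z : C} (G H : C) :
    (G ⊗ X ⟶ Y ⊗ G) →ₗ[k] (H ⊗ Y ⟶ Z ⊗ H) →ₗ[k] TubeHom k X Z :=
  (LinearMap.mk₂ k (stack G H)
    (fun f f' g => by simp [stack])
    (fun c f g => by simp [stack])
    (fun f g g' => by simp [stack])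
    (fun c f g => by simp [stack])).compr₂ (tubeMk k (H ⊗ G))

theorem stackₗ_apply {X Y Z : C} (G H : C) (f : G ⊗ X ⟶ Y ⊗ G) (g : H ⊗ Y ⟶ Z ⊗ H) :
    stackₗ k G H f g = tubeMk k (H ⊗ G) (stack G H f g) := rfl

theorem stackₗ_slide_right {X Y Z : C} (G : C) (f : G ⊗ X ⟶ Y ⊗ G) (H H' : C) (u : H ⟶ H')
    (g : H' ⊗ Y ⟶ Z ⊗ H) :
    stackₗ k G H f (u ▷ Y ≫ g) = stackₗ k G H' f (g ≫ Z ◁ u) := by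
  rw [stackₗ_apply, stackₗ_apply]
  have h1 : stack G H f (u ▷ Y ≫ g) =
      (u ▷ G) ▷ X ≫ ((α_ H' G X).hom ≫ H' ◁ f ≫ (α_ H' Y G).inv ≫ g ▷ G ≫ (α_ Z H G).hom) := by
    rw [associator_naturality_left_assoc, ← whisker_exchange_assoc,
      associator_inv_naturality_left_assoc]
    simp [stack]
  rw [h1, tubeMk_slide]
  simp [stack]

theorem stackₗ_slide_left {X Y Z : C} (H : C) (g : H ⊗ Y ⟶ Z ⊗ H) (G G' : C) (u : G ⟶ G')
    (f : G' ⊗ X ⟶ Y ⊗ G) :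
    stackₗ k G H (u ▷ X ≫ f) g = stackₗ k G' H (f ≫ Y ◁ u) g := by
  rw [stackₗ_apply, stackₗ_apply]
  have h1 : stack G H (u ▷ X ≫ f) g =
      (H ◁ u) ▷ X ≫ ((α_ H G' X).hom ≫ H ◁ f ≫ (α_ H Y G).inv ≫ g ▷ G ≫ (α_ Z H G).hom) := by
    simp [stack]
  rw [h1, tubeMk_slide]
  congr 1
  simp only [stack, Category.assoc, MonoidalCategory.whiskerLeft_comp]
  rw [associator_inv_naturality_right_assoc, whisker_exchange_assoc]
  simp

variable (k) in
/-- Composition in the tube category. -/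
def tubeComp (X Y Z : C) : TubeHom k X Y →ₗ[k] TubeHom k Y Z →ₗ[k] TubeHom k X Z :=
  tubeLift
    (fun G => LinearMap.flip (tubeLift (fun H => (stackₗ k G H).flip)
      (fun H H' u g => by
        ext f
        exact stackₗ_slide_right G f H H' u g)))
    (fun G G' u f => by
      refine tubeHom_ext fun H g => ?_
      simp only [LinearMap.flip_apply, tubeLift_mk]
      exact stackₗ_slide_left H g G G' u f)

theorem tubeComp_mk {X Y Z : C} (G H : C) (f : G ⊗ X ⟶ Y ⊗ G) (g : H ⊗ Y ⟶ Z ⊗ H) :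
    tubeComp k X Y Z (tubeMk k G f) (tubeMk k H g) = tubeMk k (H ⊗ G) (stack G H f g) := by
  simp only [tubeComp, tubeLift_mk, LinearMap.flip_apply, stackₗ_apply]

variable (k) in
/-- The identity annular morphism: no strand around the cylinder. -/
def tubeId (X : C) : TubeHom k X X := tubeMk k (𝟙_ C) ((λ_ X).hom ≫ (ρ_ X).inv)

theorem tubeComp_id_left {X Y : C} (f : TubeHom k X Y) :
    tubeComp k X X Y (tubeId k X) f = f := by
  refine LinearMap.congr_fun (f := tubeComp k X X Y (tubeId k X)) (g := LinearMap.id)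
    (tubeHom_ext fun G f => ?_) f
  rw [tubeId, tubeComp_mk, LinearMap.id_apply]
  have h1 : stack (𝟙_ C) G ((λ_ X).hom ≫ (ρ_ X).inv) f =
      (ρ_ G).hom ▷ X ≫ (f ≫ Y ◁ (ρ_ G).inv) := by
    simp [stack]
  rw [h1, tubeMk_slide]
  simp

theorem tubeComp_id_right {X Y : C} (f : TubeHom k X Y) :
    tubeComp k X Y Y f (tubeId k Y) = f := by
  refine LinearMap.congr_fun (f := (tubeComp k X Y Y).flip (tubeId k Y)) (g := LinearMap.id)
    (tubeHom_ext fun G f => ?_) f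
  rw [LinearMap.flip_apply, tubeId, tubeComp_mk, LinearMap.id_apply]
  have h1 : stack G (𝟙_ C) f ((λ_ Y).hom ≫ (ρ_ Y).inv) =
      (λ_ G).hom ▷ X ≫ (f ≫ Y ◁ (λ_ G).inv) := by
    simp [stack]
  rw [h1, tubeMk_slide]
  simp

theorem tubeHom_induction {X Y : C} {P : TubeHom k X Y → Prop} (x : TubeHom k X Y)
    (h0 : P 0) (hadd : ∀ a b, P a → P b → P (a + b))
    (hmk : ∀ (G : C) (f : G ⊗ X ⟶ Y ⊗ G), P (tubeMk k G f)) : P x := by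
  classical
  obtain ⟨y, rfl⟩ := (slideRelations k X Y).mkQ_surjective x
  induction y using DirectSum.induction_on with
  | zero => simpa using h0
  | of G f => exact hmk G f
  | add a b ha hb => rw [map_add]; exact hadd _ _ ha hb

theorem stack_assoc {W X Y Z : C} (F G H : C) (f : F ⊗ W ⟶ X ⊗ F) (g : G ⊗ X ⟶ Y ⊗ G)
    (h : H ⊗ Y ⟶ Z ⊗ H) :
    stack (G ⊗ F) H (stack F G f g) h =
      (α_ H G F).inv ▷ W ≫ (stack F (H ⊗ G) f (stack G H g h) ≫ Z ◁ (α_ H G F).hom) := by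
  simp only [stack]
  monoidal

theorem tubeComp_assoc {W X Y Z : C} (f : TubeHom k W X) (g : TubeHom k X Y) (h : TubeHom k Y Z) :
    tubeComp k W Y Z (tubeComp k W X Y f g) h = tubeComp k W X Z f (tubeComp k X Y Z g h) := by
  refine tubeHom_induction
    (P := fun f => tubeComp k W Y Z (tubeComp k W X Y f g) h =
      tubeComp k W X Z f (tubeComp k X Y Z g h)) f (by simp)
    (fun a b ha hb => by simp only [map_add, LinearMap.add_apply, ha, hb]) fun F f => ?_
  refine tubeHom_induction
    (P := fun g => tubeComp k W Y Z (tubeComp k W X Y _ g) h =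
      tubeComp k W X Z _ (tubeComp k X Y Z g h)) g (by simp)
    (fun a b ha hb => by simp only [map_add, LinearMap.add_apply, ha, hb]) fun G g => ?_
  refine tubeHom_induction
    (P := fun h => tubeComp k W Y Z (tubeComp k W X Y _ _) h =
      tubeComp k W X Z _ (tubeComp k X Y Z _ h)) h (by simp)
    (fun a b ha hb => by simp only [map_add, ha, hb]) fun H h => ?_
  rw [tubeComp_mk, tubeComp_mk, tubeComp_mk, tubeComp_mk, stack_assoc, tubeMk_slide,
    Category.assoc, ← MonoidalCategory.whiskerLeft_comp]
  simp

end Tube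

/-- The tube category of `C`: its objects are those of `C`, its morphisms are the `k`-linear
combinations of annular diagrams. -/
structure TubeCategory (k : Type w) (C : Type u) where
  /-- the underlying object of `C` -/
  base : C

section Tube

variable (k : Type w) [Field k] {C : Type u} [Category.{v} C] [Preadditive C]
  [Linear k C] [MonoidalCategory C] [MonoidalPreadditive C] [MonoidalLinear k C]

instance : Category.{max u v} (TubeCategory k C) where
  Hom X Y := TubeHom k X.base Y.base
  id X := tubeId k X.base
  comp f g := tubeComp k _ _ _ f g
  id_comp f := tubeComp_id_left f
  comp_id f := tubeComp_id_right f
  assoc f g h := tubeComp_assoc f g h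

instance (X Y : TubeCategory k C) : AddCommGroup (X ⟶ Y) :=
  inferInstanceAs (AddCommGroup (TubeHom k X.base Y.base))

instance (X Y : TubeCategory k C) : Module k (X ⟶ Y) :=
  inferInstanceAs (Module k (TubeHom k X.base Y.base))

instance : Preadditive (TubeCategory k C) where
  homGroup _ _ := inferInstance
  add_comp X Y Z f f' g := LinearMap.map_add₂ (tubeComp k X.base Y.base Z.base) f f' g
  comp_add X Y Z f g g' := map_add (tubeComp k X.base Y.base Z.base f) g g'

instance : Linear k (TubeCategory k C) where
  homModule _ _ := inferInstance
  smul_comp X Y Z c f g := LinearMap.map_smul₂ (tubeComp k X.base Y.base Z.base) c f g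
  comp_smul X Y Z f c g := map_smul (tubeComp k X.base Y.base Z.base f) c g

/-- The morphism of the tube category given by the annular diagram `f : G ⊗ X ⟶ Y ⊗ G`. -/
def annular {X Y : C} (G : C) (f : G ⊗ X ⟶ Y ⊗ G) :
    (⟨X⟩ : TubeCategory k C) ⟶ (⟨Y⟩ : TubeCategory k C) :=
  tubeMk k G f

end Tube

/-! ### The endomorphisms `γ`, `ε_X^Y` and `ε(S, A, B)` -/

section Braids

variable {C : Type u} [Category.{v} C] [MonoidalCategory C] [BraidedCategory C]

/-- The strand `T` passes from left to right, over the strand `X` and under the strand `Y`. -/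
def overUnder (T X Y : C) : T ⊗ (X ⊗ Y) ⟶ (X ⊗ Y) ⊗ T :=
  (α_ T X Y).inv ≫ (β_ T X).hom ▷ Y ≫ (α_ X T Y).hom ≫ X ◁ (β_ Y T).inv ≫ (α_ X Y T).inv

/-- The strands `P` and `Q` pass from left to right, `P` over and `Q` under the strand `S`. -/
def strandsOverUnder (P Q S : C) : (P ⊗ Q) ⊗ S ⟶ S ⊗ (P ⊗ Q) :=
  (α_ P Q S).hom ≫ P ◁ (β_ S Q).inv ≫ (α_ P S Q).inv ≫ (β_ P S).hom ▷ Q ≫ (α_ S P Q).hom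

end Braids

section Endomorphisms

variable (k : Type w) [Field k] [IsAlgClosed k] {C : Type u} [Category.{v} C] [Abelian C]
  [Linear k C] [MonoidalCategory C] [MonoidalPreadditive C] [MonoidalLinear k C]
  [BraidedCategory C] [RightRigidCategory C] [RibbonCategory C]

/-- The endomorphism `γ_{IJ}^S` of `S` in the tube category: the strands `J^∨` and `I^∨`, in this
order, run around the cylinder, `J^∨` over and `I^∨` under the strand `S`. -/
def gamma (I J S : C) : (⟨S⟩ : TubeCategory k C) ⟶ (⟨S⟩ : TubeCategory k C) :=
  annular k (Jᘁ ⊗ Iᘁ) (strandsOverUnder Jᘁ Iᘁ S)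

variable [FusionCategory k C]

/-- `b'` is the family dual to `b` under the pairing `b ⊗ b' ↦ tr(b' ∘ b)`. -/
structure IsDualFamily {X Y : C} {κ : Type*} (b : κ → (X ⟶ Y)) (b' : κ → (Y ⟶ X)) : Prop where
  pairing_self : ∀ i, tracePairing k X Y (b i) (b' i) = 1
  pairing_ne : ∀ i j, i ≠ j → tracePairing k X Y (b i) (b' j) = 0

/-- The endomorphism `ε_X^Y` of `X ⊗ Y` in the tube category. -/
def epsilonTensor {ι : Type*} [Fintype ι] (s : ι → C) (X Y : C) :
    (⟨X ⊗ Y⟩ : TubeCategory k C) ⟶ (⟨X ⊗ Y⟩ : TubeCategory k C) :=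
  (globalDim k s)⁻¹ • ∑ t, qdim k (s t) • annular k (s t) (overUnder (s t) X Y)

/-- The endomorphism `ε(S, A, B)` of `S` in the tube category, computed from a finite family `b`
in `Hom(S, A ⊗ B)` and a finite family `b'` in `Hom(A ⊗ B, S)`, to be taken as a basis and its
dual basis. -/
def epsilonIsotypic {ι : Type*} [Fintype ι] (s : ι → C) (S A B : C) {κ : Type*} [Fintype κ]
    (b : κ → (S ⟶ A ⊗ B)) (b' : κ → (A ⊗ B ⟶ S)) :
    (⟨S⟩ : TubeCategory k C) ⟶ (⟨S⟩ : TubeCategory k C) :=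
  (qdim k A * qdim k B / globalDim k s) • ∑ t, ∑ j,
    qdim k (s t) • annular k (s t) (s t ◁ b j ≫ overUnder (s t) A B ≫ b' j ▷ s t)

end Endomorphisms

/-- `e` is the projection of `X` onto its `E`-isotypic component, for a simple object `E`: an
idempotent that is the projection onto a finite direct sum of copies of `E` and through which
all morphisms `E ⟶ X` and `X ⟶ E` factor. -/
structure IsIsotypicProjection {D : Type u} [Category.{v} D] [Preadditive D] (E X : D)
    (e : X ⟶ X) : Prop where
  simple : Simple E
  idem : e ≫ e = e
  sum_of_copies : ∃ (n : ℕ) (i : Fin n → (E ⟶ X)) (p : Fin n → (X ⟶ E)),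
    (∀ a, i a ≫ p a = 𝟙 E) ∧ (∀ a b, a ≠ b → i a ≫ p b = 0) ∧ ∑ a, p a ≫ i a = e
  comp_eq : ∀ f : E ⟶ X, f ≫ e = f
  eq_comp : ∀ f : X ⟶ E, e ≫ f = f

end TubeS

end

noncomputable section

universe w v u

set_option linter.unusedSectionVars false

namespace TubeS

/-! ### Sliding strands across cups and caps -/

section Braided

open BraidedCategory

variable {C : Type u} [Category.{v} C] [MonoidalCategory C] [BraidedCategory C]

/-! Write ⟨X,Y⟩ for (X ⊗ Y, ε_X^Y). Everything rests on knowing the maps into ⟨X,Y⟩. A loop coloured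
by Σ_T d(T) T that crosses an object by a half braiding absorbs every annular strand composed before
it (the handle slide, `HB.comp_loop`): that strand is closed up through the half braiding and
becomes a morphism of C. As d(C) ≠ 0, composing with ε_X^Y is a bijection from Hom_C(Z, X ⊗ Y) to
the maps Z → ⟨X,Y⟩, inverted by `HB.unwind`. In particular ε_X^Y is idempotent.

Modularity enters through the Kirby sum Σ_T d(T) S_{T,N}. It is d(C) for N ≅ 1 and vanishes for
every other simple N (`sum_qdim_sEntry_eq_zero`); invertibility of S also forces d(T) ≠ 0 and d(C) ≠
0. The sum is used twice. Schur's lemma: a morphism A ⊗ B → A' ⊗ B' is a sum of morphisms in which a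
simple strand N is exchanged between the two factors. Between two ε's the Kirby loop encircles N, so
only N ≅ 1 survives, that is, morphisms a ⊗ b (`epsilonTensor_comp_mem`). Hence there are no maps
between different ⟨A,B⟩, and endomorphisms are scalars. Completeness: Σ_{A,B} ε(S,A,B) = id
(`sum_epsilonIsotypic`). With B bent back, the sum over A fuses the dual bases to an identity; what
remains is T passing over S with a ring B around T, and the sum over B kills every T except the
unit.

For the formula, let γ be followed by a morphism S → A ⊗ B and ε_A^B. Both strands are absorbed: J^∨
passes over both factors, comes free of A and rings B; I^∨ passes under both, comes free of B and
rings A. Rings around simple objects are the scalars S_{B,J^∨}/d(B) and S_{I,A}/d(A)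
(`gamma_comp_emb`), and composing the completeness relation with γ gives the expansion. The isotypic
statement follows from completeness and Schur's lemma: together with linear independence of b they
give the orthogonality of the copies of ⟨A,B⟩ in S (`epsilonTensor_comp_emb_dual`), and they split
every nonzero map into ⟨A,B⟩ (`epsilonTensor_factor`). -/

theorem hexagon_right (X Y Z : C) : (β_ X (Y ⊗ Z)).hom =
    𝟙 _ ⊗≫ (β_ X Y).hom ▷ Z ⊗≫ Y ◁ (β_ X Z).hom ⊗≫ 𝟙 _ := by
  rw [braiding_tensor_right_hom]; monoidal

theorem hexagon_left (X Y Z : C) : (β_ (X ⊗ Y) Z).hom =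
    𝟙 _ ⊗≫ X ◁ (β_ Y Z).hom ⊗≫ (β_ X Z).hom ▷ Y ⊗≫ 𝟙 _ := by
  rw [braiding_tensor_left_hom]; monoidal

/-- A strand passing over a coevaluation. -/
theorem whiskerLeft_unit_braiding (X : C) {Y Z : C} (n : 𝟙_ C ⟶ Y ⊗ Z) :
    X ◁ n ⊗≫ (β_ X Y).hom ▷ Z ⊗≫ Y ◁ (β_ X Z).hom =
      𝟙 (X ⊗ 𝟙_ C) ⊗≫ n ▷ X ⊗≫ 𝟙 (Y ⊗ Z ⊗ X) := by
  have h := braiding_naturality_right X n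
  rw [hexagon_right, braiding_tensorUnit_right] at h
  calc
    _ = (X ◁ n ≫ 𝟙 _ ⊗≫ (β_ X Y).hom ▷ Z ⊗≫ Y ◁ (β_ X Z).hom ⊗≫ 𝟙 ((Y ⊗ Z) ⊗ X)) ⊗≫
        𝟙 (Y ⊗ Z ⊗ X) := by monoidal
    _ = _ := by rw [h]; monoidal

/-- A strand passing over an evaluation. -/
theorem braiding_whiskerLeft_counit (X : C) {Y Z : C} (e : Y ⊗ Z ⟶ 𝟙_ C) :
    (β_ X Y).hom ▷ Z ⊗≫ Y ◁ (β_ X Z).hom ⊗≫ e ▷ X ⊗≫ 𝟙 X =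
      𝟙 ((X ⊗ Y) ⊗ Z) ⊗≫ X ◁ e ⊗≫ 𝟙 X := by
  have h := braiding_naturality_right X e
  rw [hexagon_right, braiding_tensorUnit_right] at h
  calc
    _ = 𝟙 ((X ⊗ Y) ⊗ Z) ⊗≫ ((𝟙 (X ⊗ Y ⊗ Z) ⊗≫ (β_ X Y).hom ▷ Z ⊗≫
          Y ◁ (β_ X Z).hom ⊗≫ 𝟙 ((Y ⊗ Z) ⊗ X)) ≫ e ▷ X) ⊗≫
        𝟙 X := by monoidal
    _ = _ := by rw [← h]; monoidal

/-- A strand passing under an evaluation. -/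
theorem braiding_whiskerRight_counit (X : C) {Y Z : C} (e : Y ⊗ Z ⟶ 𝟙_ C) :
    Y ◁ (β_ Z X).hom ⊗≫ (β_ Y X).hom ▷ Z ⊗≫ X ◁ e ⊗≫ 𝟙 X =
      𝟙 (Y ⊗ (Z ⊗ X)) ⊗≫ e ▷ X ⊗≫ 𝟙 X := by
  have h := braiding_naturality_left e X
  rw [hexagon_left, braiding_tensorUnit_left] at h
  calc
    _ = 𝟙 (Y ⊗ (Z ⊗ X)) ⊗≫ ((𝟙 ((Y ⊗ Z) ⊗ X) ⊗≫ Y ◁ (β_ Z X).hom ⊗≫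
          (β_ Y X).hom ▷ Z ⊗≫ 𝟙 (X ⊗ Y ⊗ Z)) ≫ X ◁ e) ⊗≫
        𝟙 X := by monoidal
    _ = _ := by rw [← h]; monoidal

end Braided

/-! ### The pivotal structure of a ribbon category and its trace -/

section Pivotal

open ExactPairing BraidedCategory

variable {C : Type u} [Category.{v} C] [MonoidalCategory C] [BraidedCategory C]
  [RightRigidCategory C] [RibbonCategory C]

/-- The component of the twist at `X`. -/
def tw (X : C) : X ⟶ X := (RibbonCategory.twist (C := C)).hom.app X

instance (X : C) : IsIso (tw X) := by unfold tw; infer_instance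

theorem tw_naturality {X Y : C} (f : X ⟶ Y) : f ≫ tw Y = tw X ≫ f :=
  (RibbonCategory.twist (C := C)).hom.naturality f

theorem tw_tensor (X Y : C) :
    tw (X ⊗ Y) = (tw X ⊗ₘ tw Y) ≫ (β_ X Y).hom ≫ (β_ Y X).hom :=
  RibbonCategory.twist_tensor X Y

theorem tw_dual (X : C) : (rightAdjointMate (tw X) : Xᘁ ⟶ Xᘁ) = tw Xᘁ :=
  RibbonCategory.twist_dual X

-- Balancing on 1 ⊗ 1 and naturality along the unitor give θ = θ², and θ is invertible.
@[simp]
theorem tw_unit : tw (𝟙_ C) = 𝟙 _ := by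
  have h1 := tw_tensor (𝟙_ C) (𝟙_ C)
  have h2 := tw_naturality (λ_ (𝟙_ C)).hom
  rw [h1, MonoidalCategory.tensorHom_def] at h2
  simp only[braiding_tensorUnit_left, Category.assoc, Iso.inv_hom_id_assoc, Iso.inv_hom_id,
    unitors_equal, Category.comp_id] at h2
  rw [← unitors_equal, leftUnitor_naturality, unitors_equal, rightUnitor_naturality_assoc,
    Iso.cancel_iso_hom_left] at h2
  exact ((cancel_epi (tw (𝟙_ C))).mp ((Category.comp_id _).trans h2)).symm

/-- The left coevaluation `1 ⟶ X^∨ ⊗ X` of the pivotal structure. -/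
def coevL (X : C) : 𝟙_ C ⟶ Xᘁ ⊗ X := η_ X Xᘁ ≫ tw X ▷ Xᘁ ≫ (β_ X Xᘁ).hom

/-- The left evaluation `X ⊗ X^∨ ⟶ 1` of the pivotal structure. -/
def evL (X : C) : X ⊗ Xᘁ ⟶ 𝟙_ C := tw X ▷ Xᘁ ≫ (β_ X Xᘁ).hom ≫ ε_ X Xᘁ

/-- The quantum trace as an endomorphism of the unit. -/
def trHom {X : C} (f : X ⟶ X) : 𝟙_ C ⟶ 𝟙_ C :=
  η_ X Xᘁ ≫ (f ≫ tw X) ▷ Xᘁ ≫ (β_ X Xᘁ).hom ≫ ε_ X Xᘁ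

theorem trHom_eq_right {X : C} (f : X ⟶ X) : trHom f = η_ X Xᘁ ≫ f ▷ Xᘁ ≫ evL X := by
  simp [trHom, evL]

theorem trHom_eq_left {X : C} (f : X ⟶ X) : trHom f = coevL X ≫ Xᘁ ◁ f ≫ ε_ X Xᘁ := by
  rw [trHom, tw_naturality]
  simp [coevL]

theorem coevL_naturality {X Y : C} (f : X ⟶ Y) :
    coevL X ≫ Xᘁ ◁ f = coevL Y ≫ (fᘁ) ▷ Y := by
  simp only [coevL, Category.assoc]
  rw [← braiding_naturality_left, ← braiding_naturality_right, ← comp_whiskerRight_assoc,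
    ← tw_naturality, ← whisker_exchange_assoc, coevaluation_comp_rightAdjointMate_assoc]
  simp

theorem evaluation_naturality {X Y : C} (f : X ⟶ Y) :
    (fᘁ) ▷ X ≫ ε_ X Xᘁ = Yᘁ ◁ f ≫ ε_ Y Yᘁ :=
  rightAdjointMate_comp_evaluation f

theorem trHom_comm {X Y : C} (f : X ⟶ Y) (g : Y ⟶ X) : trHom (f ≫ g) = trHom (g ≫ f) := by
  rw [trHom_eq_left, trHom_eq_left, whiskerLeft_comp, whiskerLeft_comp, Category.assoc,
    reassoc_of% (coevL_naturality f), Category.assoc, ← whisker_exchange_assoc,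
    evaluation_naturality]

/-- The trace does not depend on the chosen dual: the mate of the identity compares the two duals.
This allows Y^∨ ⊗ X^∨ as the dual of X ⊗ Y. -/
theorem trHom_eq_of_exactPairing {X Y : C} (p : ExactPairing X Y) (f : X ⟶ X) :
    trHom f = η_ X Y ≫ (f ≫ tw X) ▷ Y ≫ (β_ X Y).hom ≫ ε_ X Y := by
  let φ : Xᘁ ⟶ Y := @rightAdjointMate C _ _ X X ⟨Y⟩ _ (𝟙 X)
  have h1 : η_ X Xᘁ ≫ X ◁ φ = η_ X Y := by
    have := @coevaluation_comp_rightAdjointMate C _ _ X X ⟨Y⟩ _ (𝟙 X)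
    rwa [id_whiskerRight, Category.comp_id] at this
  have h2 : φ ▷ X ≫ ε_ X Y = ε_ X Xᘁ := by
    have := @rightAdjointMate_comp_evaluation C _ _ X X ⟨Y⟩ _ (𝟙 X)
    rwa [whiskerLeft_id, Category.id_comp] at this
  rw [← h1, Category.assoc, whisker_exchange_assoc, braiding_naturality_right_assoc, h2, trHom]

/-- The exact pairing between `X^∨` and `X` given by the pivotal structure. -/
@[reducible]
def pivotalExactPairing (X : C) : ExactPairing Xᘁ X :=
  haveI := exactPairing_swap X Xᘁ
  exactPairingCongrRight (asIso (tw X))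

theorem pivotal_evaluation (X : C) :
    @ExactPairing.evaluation _ _ _ Xᘁ X (pivotalExactPairing X) = evL X := by
  rfl

/-- The transported coevaluation uses the inverse braiding and the inverse twist. It agrees with
`coevL` because θ_{X ⊗ X^∨} acts trivially on η and θ_{X^∨} is the mate of θ_X. -/
theorem pivotal_coevaluation (X : C) :
    @ExactPairing.coevaluation _ _ _ Xᘁ X (pivotalExactPairing X) = coevL X := by
  have h : η_ X Xᘁ ≫ tw (X ⊗ Xᘁ) = η_ X Xᘁ := by simp [tw_naturality]
  have h2 : η_ X Xᘁ ≫ X ◁ tw Xᘁ = η_ X Xᘁ ≫ tw X ▷ Xᘁ := by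
    rw [← tw_dual, coevaluation_comp_rightAdjointMate]
  change (η_ X Xᘁ ≫ (β_ Xᘁ X).inv) ≫ Xᘁ ◁ inv (tw X) = coevL X
  rw [← inv_whiskerLeft, IsIso.comp_inv_eq, Iso.comp_inv_eq, coevL]
  simp only [Category.assoc]
  have h3 : η_ X Xᘁ ≫ tw X ▷ Xᘁ ≫ X ◁ tw Xᘁ ≫ (β_ X Xᘁ).hom ≫ (β_ Xᘁ X).hom = η_ X Xᘁ := by
    conv_rhs => rw [← h, tw_tensor, MonoidalCategory.tensorHom_def]
    simp
  rw [← braiding_naturality_left_assoc, ← reassoc_of% h2,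
    whisker_exchange_assoc]
  exact h3.symm

theorem trHom_dual {X : C} (h : Xᘁ ⟶ Xᘁ) : trHom h = coevL X ≫ h ▷ X ≫ ε_ X Xᘁ := by
  have h2 : η_ X Xᘁ ≫ X ◁ tw Xᘁ = η_ X Xᘁ ≫ tw X ▷ Xᘁ := by
    rw [← tw_dual, coevaluation_comp_rightAdjointMate]
  rw [trHom_eq_of_exactPairing (exactPairing_swap X Xᘁ) h]
  change (η_ X Xᘁ ≫ (β_ Xᘁ X).inv) ≫ _ ≫ _ ≫ (β_ X Xᘁ).hom ≫ ε_ X Xᘁ = _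
  rw [braiding_naturality_left_assoc, Category.assoc, Iso.inv_hom_id_assoc, tw_naturality,
    whiskerLeft_comp, Category.assoc, reassoc_of% h2, braiding_naturality_right_assoc]
  simp [coevL]

/-- Sliding first X and then Y over the other's cup undoes the linking, leaving two nested curls. -/
theorem doubleBraiding_closure (X Y : C) :
    η_ (X ⊗ Y) (Yᘁ ⊗ Xᘁ) ≫ ((β_ X Y).hom ≫ (β_ Y X).hom) ▷ (Yᘁ ⊗ Xᘁ) ≫
        (β_ (X ⊗ Y) (Yᘁ ⊗ Xᘁ)).hom =
      𝟙 _ ⊗≫ (η_ Y Yᘁ ≫ (β_ Y Yᘁ).hom) ⊗≫ Yᘁ ◁ (η_ X Xᘁ ≫ (β_ X Xᘁ).hom) ▷ Y ⊗≫ 𝟙 _ := by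
  calc
    _ = 𝟙 _ ⊗≫ η_ X Xᘁ ⊗≫ X ◁ η_ Y Yᘁ ▷ Xᘁ ⊗≫ (β_ X Y).hom ▷ Yᘁ ▷ Xᘁ ⊗≫
        ((β_ Y X).hom ▷ Yᘁ ≫ (β_ (X ⊗ Y) Yᘁ).hom) ▷ Xᘁ ⊗≫
          Yᘁ ◁ (β_ (X ⊗ Y) Xᘁ).hom ⊗≫ 𝟙 _ := by
      rw [tensor_coevaluation, hexagon_right (X ⊗ Y)]; monoidal
    _ = 𝟙 _ ⊗≫ η_ X Xᘁ ⊗≫ (X ◁ η_ Y Yᘁ ⊗≫ (β_ X Y).hom ▷ Yᘁ ⊗≫ Y ◁ (β_ X Yᘁ).hom) ▷ Xᘁ ⊗≫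
        (β_ Y Yᘁ).hom ▷ (X ⊗ Xᘁ) ⊗≫ Yᘁ ◁ ((β_ Y X).hom ▷ Xᘁ ⊗≫ X ◁ (β_ Y Xᘁ).hom) ⊗≫
          Yᘁ ◁ ((β_ X Xᘁ).hom ▷ Y) ⊗≫ 𝟙 _ := by
      rw [braiding_naturality_left, hexagon_left Y X, hexagon_left X Y]; monoidal
    _ = 𝟙 _ ⊗≫ (𝟙_ C ◁ η_ X Xᘁ ≫ (η_ Y Yᘁ ≫ (β_ Y Yᘁ).hom) ▷ (X ⊗ Xᘁ)) ⊗≫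
        Yᘁ ◁ ((β_ Y X).hom ▷ Xᘁ ⊗≫ X ◁ (β_ Y Xᘁ).hom) ⊗≫
          Yᘁ ◁ ((β_ X Xᘁ).hom ▷ Y) ⊗≫ 𝟙 _ := by
      rw [whiskerLeft_unit_braiding]; monoidal
    _ = 𝟙 _ ⊗≫ (η_ Y Yᘁ ≫ (β_ Y Yᘁ).hom) ⊗≫
        Yᘁ ◁ (Y ◁ η_ X Xᘁ ⊗≫ (β_ Y X).hom ▷ Xᘁ ⊗≫ X ◁ (β_ Y Xᘁ).hom) ⊗≫
          Yᘁ ◁ ((β_ X Xᘁ).hom ▷ Y) ⊗≫ 𝟙 _ := by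
      rw [whisker_exchange]; monoidal
    _ = _ := by
      rw [whiskerLeft_unit_braiding]; monoidal

/-- The pivotal structure is monoidal: the double braiding in the balancing axiom is exactly the one
removed by `doubleBraiding_closure`. -/
theorem coevL_tensor (X Y : C) :
    η_ (X ⊗ Y) (Yᘁ ⊗ Xᘁ) ≫ tw (X ⊗ Y) ▷ (Yᘁ ⊗ Xᘁ) ≫ (β_ (X ⊗ Y) (Yᘁ ⊗ Xᘁ)).hom =
      𝟙 _ ⊗≫ coevL Y ⊗≫ Yᘁ ◁ coevL X ▷ Y ⊗≫ 𝟙 _ := by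
  have h : tw (X ⊗ Y) = ((β_ X Y).hom ≫ (β_ Y X).hom) ≫ (tw X ⊗ₘ tw Y) := by
    rw [tw_tensor, braiding_naturality_assoc, braiding_naturality, Category.assoc]
  have h2 (Z : C) : coevL Z = (η_ Z Zᘁ ≫ (β_ Z Zᘁ).hom) ≫ Zᘁ ◁ tw Z := by
    rw [coevL, braiding_naturality_left, Category.assoc]
  rw [h, comp_whiskerRight, Category.assoc, braiding_naturality_left,
    reassoc_of% (doubleBraiding_closure X Y), MonoidalCategory.tensorHom_def', h2, h2]
  calc
    _ = 𝟙 _ ⊗≫ (η_ Y Yᘁ ≫ (β_ Y Yᘁ).hom) ⊗≫ Yᘁ ◁ ((η_ X Xᘁ ≫ (β_ X Xᘁ).hom) ▷ Y ≫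
          (Xᘁ ⊗ X) ◁ tw Y) ⊗≫ Yᘁ ◁ Xᘁ ◁ tw X ▷ Y ⊗≫ 𝟙 _ := by monoidal
    _ = _ := by rw [← whisker_exchange]; monoidal

/-- The trace over a tensor product, computed by closing the left strand first. -/
theorem trHom_tensor {X Y : C} (f : X ⊗ Y ⟶ X ⊗ Y) :
    trHom f = trHom (𝟙 Y ⊗≫ coevL X ▷ Y ⊗≫ Xᘁ ◁ f ⊗≫ ε_ X Xᘁ ▷ Y ⊗≫ 𝟙 Y) := by
  rw [trHom_eq_of_exactPairing (ExactPairing.tensor (X₁ := X) (X₂ := Y) (Y₁ := Xᘁ) (Y₂ := Yᘁ)) f,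
    tw_naturality, comp_whiskerRight,
    Category.assoc, braiding_naturality_left_assoc, reassoc_of% (coevL_tensor X Y),
    tensor_evaluation, trHom_eq_left]
  monoidal

end Pivotal

/-! ### Duality data that close a strand on either side -/

section PivotalPairs

open ExactPairing BraidedCategory

variable {C : Type u} [Category.{v} C] [MonoidalCategory C] [BraidedCategory C]
  [RightRigidCategory C] [RibbonCategory C]

/-- Two-sided duality data between `X` and `Y` whose right closure computes the quantum trace. -/
structure PivotalPair (X Y : C) where
  /-- right coevaluation -/
  n : 𝟙_ C ⟶ X ⊗ Y
  /-- right evaluation -/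
  c : Y ⊗ X ⟶ 𝟙_ C
  /-- left coevaluation -/
  m : 𝟙_ C ⟶ Y ⊗ X
  /-- left evaluation -/
  e : X ⊗ Y ⟶ 𝟙_ C
  snake_n_c : n ▷ X ⊗≫ X ◁ c = ⊗𝟙.hom
  snake_c_n : Y ◁ n ⊗≫ c ▷ Y = ⊗𝟙.hom
  snake_m_e : m ▷ Y ⊗≫ Y ◁ e = ⊗𝟙.hom
  snake_e_m : X ◁ m ⊗≫ e ▷ X = ⊗𝟙.hom
  trace : ∀ f : X ⟶ X, n ≫ f ▷ Y ≫ e = trHom f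

/-- The pair of an object and its dual. -/
def PivotalPair.dual (X : C) : PivotalPair X Xᘁ where
  n := η_ X Xᘁ
  c := ε_ X Xᘁ
  m := coevL X
  e := evL X
  snake_n_c := evaluation_coevaluation'' X Xᘁ
  snake_c_n := coevaluation_evaluation'' X Xᘁ
  snake_m_e := by
    have := @evaluation_coevaluation'' _ _ _ Xᘁ X (pivotalExactPairing X)
    rwa [pivotal_evaluation, pivotal_coevaluation] at this
  snake_e_m := by
    have := @coevaluation_evaluation'' _ _ _ Xᘁ X (pivotalExactPairing X)
    rwa [pivotal_evaluation, pivotal_coevaluation] at this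
  trace f := (trHom_eq_right f).symm

/-- The pair of the dual of an object and the object. -/
def PivotalPair.codual (X : C) : PivotalPair Xᘁ X where
  n := coevL X
  c := evL X
  m := η_ X Xᘁ
  e := ε_ X Xᘁ
  snake_n_c := (PivotalPair.dual X).snake_m_e
  snake_c_n := (PivotalPair.dual X).snake_e_m
  snake_m_e := (PivotalPair.dual X).snake_n_c
  snake_e_m := (PivotalPair.dual X).snake_c_n
  trace f := (trHom_dual f).symm

/-- The trace over a tensor product, computed by closing the right strand first. -/
theorem PivotalPair.trHom_tensor {X Y Y' : C} (P : PivotalPair Y Y') (g : X ⊗ Y ⟶ X ⊗ Y) :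
    trHom g = trHom (𝟙 X ⊗≫ X ◁ P.n ⊗≫ g ▷ Y' ⊗≫ X ◁ P.e ⊗≫ 𝟙 X) := by
  rw [TubeS.trHom_tensor, ← P.trace, trHom_eq_left]
  calc
    _ = 𝟙 _ ⊗≫ (𝟙_ C ◁ P.n ≫ coevL X ▷ (Y ⊗ Y')) ⊗≫ Xᘁ ◁ g ▷ Y' ⊗≫
          (ε_ X Xᘁ ▷ (Y ⊗ Y') ≫ 𝟙_ C ◁ P.e) ⊗≫ 𝟙 _ := by monoidal
    _ = _ := by rw [whisker_exchange (coevL X) P.n, ← whisker_exchange (ε_ X Xᘁ) P.e]; monoidal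

end PivotalPairs

/-! ### Half braidings and closures of annular diagrams -/

section HalfBraidings

open ExactPairing BraidedCategory

variable {C : Type u} [Category.{v} C] [MonoidalCategory C]

/-- A half braiding: strands pass from left to right across the object `Z`. -/
structure HB (Z : C) where
  /-- the crossing -/
  σ : ∀ T, T ⊗ Z ⟶ Z ⊗ T
  nat : ∀ {T U} (f : T ⟶ U), f ▷ Z ≫ σ U = σ T ≫ Z ◁ f
  tensor : ∀ T U, σ (T ⊗ U) = 𝟙 _ ⊗≫ T ◁ σ U ⊗≫ σ T ▷ U ⊗≫ 𝟙 _
  unit : σ (𝟙_ C) = (λ_ Z).hom ≫ (ρ_ Z).inv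

/-- The half braiding on a tensor product. -/
def HB.prod {X Y : C} (h : HB X) (l : HB Y) : HB (X ⊗ Y) where
  σ T := 𝟙 _ ⊗≫ h.σ T ▷ Y ⊗≫ X ◁ l.σ T ⊗≫ 𝟙 _
  nat {T U} f := by
    calc
      _ = 𝟙 _ ⊗≫ (f ▷ X ≫ h.σ U) ▷ Y ⊗≫ X ◁ l.σ U ⊗≫ 𝟙 _ := by monoidal
      _ = 𝟙 _ ⊗≫ h.σ T ▷ Y ⊗≫ X ◁ (f ▷ Y ≫ l.σ U) ⊗≫ 𝟙 _ := by rw [h.nat]; monoidal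
      _ = _ := by rw [l.nat]; monoidal
  tensor T U := by
    calc
      _ = 𝟙 _ ⊗≫ T ◁ h.σ U ▷ Y ⊗≫ (h.σ T ▷ (U ⊗ Y) ≫ (X ⊗ T) ◁ l.σ U) ⊗≫
          X ◁ l.σ T ▷ U ⊗≫ 𝟙 _ := by rw [h.tensor, l.tensor]; monoidal
      _ = _ := by rw [← whisker_exchange]; monoidal
  unit := by rw [h.unit, l.unit]; monoidal

section

variable [BraidedCategory C]

/-- Strands pass over `X`. -/
def HB.over (X : C) : HB X where
  σ T := (β_ T X).hom
  nat f := braiding_naturality_left f X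
  tensor T U := by rw [braiding_tensor_left_hom]; monoidal
  unit := by rw [braiding_tensorUnit_left]

/-- Strands pass under `X`. -/
def HB.under (X : C) : HB X where
  σ T := (β_ X T).inv
  nat f := braiding_inv_naturality_left f X
  tensor T U := by rw [braiding_tensor_right_inv]; monoidal
  unit := by rw [braiding_inv_tensorUnit_right]

theorem overUnder_eq (T X Y : C) :
    overUnder T X Y = ((HB.over X).prod (HB.under Y)).σ T := by
  simp only [overUnder, HB.prod, HB.over, HB.under]; monoidal

variable [RightRigidCategory C] [RibbonCategory C]

/-- The closure of an annular diagram across a half braiding. -/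
def HB.closure {Z Y : C} (h : HB Z) (U : C) (f : U ⊗ Y ⟶ Z ⊗ U) : Y ⟶ Z :=
  𝟙 Y ⊗≫ coevL U ▷ Y ⊗≫ Uᘁ ◁ f ⊗≫ h.σ Uᘁ ▷ U ⊗≫ Z ◁ ε_ U Uᘁ ⊗≫ 𝟙 Z

/-- Dinaturality in the strand, by which the closure descends to the coend (`HB.unwind`). -/
theorem HB.closure_slide {Z Y G H : C} (h : HB Z) (u : G ⟶ H) (f : H ⊗ Y ⟶ Z ⊗ G) :
    h.closure G (u ▷ Y ≫ f) = h.closure H (f ≫ Z ◁ u) := by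
  simp only [HB.closure]
  calc
    _ = 𝟙 Y ⊗≫ (coevL G ≫ Gᘁ ◁ u) ▷ Y ⊗≫ Gᘁ ◁ f ⊗≫ h.σ Gᘁ ▷ G ⊗≫ Z ◁ ε_ G Gᘁ ⊗≫ 𝟙 Z := by
      monoidal
    _ = 𝟙 Y ⊗≫ coevL H ▷ Y ⊗≫ ((uᘁ) ▷ (H ⊗ Y) ≫ Gᘁ ◁ f) ⊗≫ h.σ Gᘁ ▷ G ⊗≫
          Z ◁ ε_ G Gᘁ ⊗≫ 𝟙 Z := by
      rw [coevL_naturality]; monoidal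
    _ = 𝟙 Y ⊗≫ coevL H ▷ Y ⊗≫ Hᘁ ◁ f ⊗≫ ((uᘁ) ▷ Z ≫ h.σ Gᘁ) ▷ G ⊗≫
          Z ◁ ε_ G Gᘁ ⊗≫ 𝟙 Z := by
      rw [← whisker_exchange]; monoidal
    _ = 𝟙 Y ⊗≫ coevL H ▷ Y ⊗≫ Hᘁ ◁ f ⊗≫ h.σ Hᘁ ▷ G ⊗≫
          Z ◁ ((uᘁ) ▷ G ≫ ε_ G Gᘁ) ⊗≫ 𝟙 Z := by
      rw [h.nat]; monoidal
    _ = 𝟙 Y ⊗≫ coevL H ▷ Y ⊗≫ Hᘁ ◁ f ⊗≫ (h.σ Hᘁ ▷ G ≫ (Z ⊗ Hᘁ) ◁ u) ⊗≫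
          Z ◁ ε_ H Hᘁ ⊗≫ 𝟙 Z := by
      rw [evaluation_naturality]; monoidal
    _ = _ := by
      rw [← whisker_exchange]; monoidal

theorem HB.closure_comp_left {Z Y Y' : C} (h : HB Z) (U : C) (m : Y' ⟶ Y) (f : U ⊗ Y ⟶ Z ⊗ U) :
    h.closure U (U ◁ m ≫ f) = m ≫ h.closure U f := by
  simp only [HB.closure]
  calc
    _ = 𝟙 Y' ⊗≫ (coevL U ▷ Y' ≫ (Uᘁ ⊗ U) ◁ m) ⊗≫ Uᘁ ◁ f ⊗≫ h.σ Uᘁ ▷ U ⊗≫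
          Z ◁ ε_ U Uᘁ ⊗≫ 𝟙 Z := by monoidal
    _ = _ := by rw [← whisker_exchange]; monoidal

theorem HB.closure_comp_right {Z Z' Y : C} (h : HB Z) (h' : HB Z') (U : C) (f : U ⊗ Y ⟶ Z ⊗ U)
    (m : Z ⟶ Z') (hm : h.σ Uᘁ ≫ m ▷ Uᘁ = Uᘁ ◁ m ≫ h'.σ Uᘁ) :
    h'.closure U (f ≫ m ▷ U) = h.closure U f ≫ m := by
  simp only [HB.closure]
  calc
    _ = 𝟙 Y ⊗≫ coevL U ▷ Y ⊗≫ Uᘁ ◁ f ⊗≫ (Uᘁ ◁ m ≫ h'.σ Uᘁ) ▷ U ⊗≫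
          Z' ◁ ε_ U Uᘁ ⊗≫ 𝟙 Z' := by monoidal
    _ = 𝟙 Y ⊗≫ coevL U ▷ Y ⊗≫ Uᘁ ◁ f ⊗≫ h.σ Uᘁ ▷ U ⊗≫ (m ▷ (Uᘁ ⊗ U) ≫
          Z' ◁ ε_ U Uᘁ) ⊗≫ 𝟙 Z' := by rw [← hm]; monoidal
    _ = _ := by rw [← whisker_exchange]; monoidal

/-- The crossings of U and U^∨ combine into one crossing by U^∨ ⊗ U; by naturality the whole circle
leaves Z. -/
theorem HB.closure_self {Z : C} (h : HB Z) (U : C) :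
    h.closure U (h.σ U) = 𝟙 Z ⊗≫ (coevL U ≫ ε_ U Uᘁ) ▷ Z ⊗≫ 𝟙 Z := by
  simp only [HB.closure]
  calc
    _ = 𝟙 Z ⊗≫ coevL U ▷ Z ⊗≫ (h.σ (Uᘁ ⊗ U) ≫ Z ◁ ε_ U Uᘁ) ⊗≫ 𝟙 Z := by
      rw [h.tensor]; monoidal
    _ = _ := by rw [← h.nat, h.unit]; monoidal

/-- The strand goes out and comes back across P by the same half braiding, so by naturality at the
coevaluation it slides off P. For `HB.closure_prod_right` the evaluation plays this role. -/
theorem HB.closure_prod_left {P Q Y : C} (h : HB P) (l : HB Q) (U : C) (f : U ⊗ Y ⟶ Q ⊗ U) :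
    (h.prod l).closure U (𝟙 _ ⊗≫ h.σ U ▷ Y ⊗≫ P ◁ f ⊗≫ 𝟙 _) = P ◁ l.closure U f := by
  simp only [HB.closure]
  calc
    _ = 𝟙 _ ⊗≫ coevL U ▷ P ▷ Y ⊗≫ Uᘁ ◁ h.σ U ▷ Y ⊗≫ (Uᘁ ◁ P ◁ f ⊗≫ h.σ Uᘁ ▷ (Q ⊗ U)) ⊗≫
          P ◁ l.σ Uᘁ ▷ U ⊗≫ P ◁ Q ◁ ε_ U Uᘁ ⊗≫ 𝟙 _ := by
      simp only [HB.prod]; monoidal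
    _ = 𝟙 _ ⊗≫ coevL U ▷ P ▷ Y ⊗≫ Uᘁ ◁ h.σ U ▷ Y ⊗≫ ((Uᘁ ⊗ P) ◁ f ≫ h.σ Uᘁ ▷ (Q ⊗ U)) ⊗≫
          P ◁ l.σ Uᘁ ▷ U ⊗≫ P ◁ Q ◁ ε_ U Uᘁ ⊗≫ 𝟙 _ := by monoidal
    _ = 𝟙 _ ⊗≫ (coevL U ▷ P ≫ h.σ (Uᘁ ⊗ U)) ▷ Y ⊗≫ P ◁ Uᘁ ◁ f ⊗≫
          P ◁ l.σ Uᘁ ▷ U ⊗≫ P ◁ Q ◁ ε_ U Uᘁ ⊗≫ 𝟙 _ := by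
      rw [whisker_exchange, h.tensor]; monoidal
    _ = _ := by rw [h.nat, h.unit]; monoidal

theorem HB.closure_prod_right {P Q Y : C} (h : HB P) (l : HB Q) (U : C) (f : U ⊗ Y ⟶ P ⊗ U) :
    (h.prod l).closure U (𝟙 _ ⊗≫ f ▷ Q ⊗≫ P ◁ l.σ U ⊗≫ 𝟙 _) = h.closure U f ▷ Q := by
  simp only [HB.closure]
  calc
    _ = 𝟙 _ ⊗≫ coevL U ▷ Y ▷ Q ⊗≫ Uᘁ ◁ f ▷ Q ⊗≫ ((Uᘁ ⊗ P) ◁ l.σ U ≫ h.σ Uᘁ ▷ (Q ⊗ U)) ⊗≫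
          P ◁ l.σ Uᘁ ▷ U ⊗≫ P ◁ Q ◁ ε_ U Uᘁ ⊗≫ 𝟙 _ := by
      simp only [HB.prod]; monoidal
    _ = 𝟙 _ ⊗≫ coevL U ▷ Y ▷ Q ⊗≫ Uᘁ ◁ f ▷ Q ⊗≫ h.σ Uᘁ ▷ U ▷ Q ⊗≫
          P ◁ (l.σ (Uᘁ ⊗ U) ≫ Q ◁ ε_ U Uᘁ) ⊗≫ 𝟙 _ := by
      rw [whisker_exchange, l.tensor]; monoidal
    _ = _ := by rw [← l.nat, l.unit]; monoidal

end

end HalfBraidings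

/-! ### Rings around an object -/

section Rings

open ExactPairing BraidedCategory

variable {C : Type u} [Category.{v} C] [MonoidalCategory C] [BraidedCategory C]

variable [RightRigidCategory C] [RibbonCategory C]

/-- The strand `U` runs around `N`, first over, then under. -/
def ringOver (U N : C) : N ⟶ N := (HB.under N).closure U (β_ U N).hom

/-- The strand `U` runs around `N`, first under, then over. -/
def ringUnder (U N : C) : N ⟶ N := (HB.over N).closure U (β_ N U).inv

/-- After inserting a cancelling pair of crossings of N with U^∨, N slides over the evaluation. The
ring is thus a partial trace of the double braiding, and its trace is a Hopf link. -/
theorem ringOver_eq (U N : C) :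
    ringOver U N = 𝟙 N ⊗≫ coevL U ▷ N ⊗≫ Uᘁ ◁ ((β_ U N).hom ≫ (β_ N U).hom) ⊗≫
      ε_ U Uᘁ ▷ N ⊗≫ 𝟙 N := by
  simp only [ringOver, HB.closure, HB.under]
  symm
  calc
    _ = 𝟙 N ⊗≫ coevL U ▷ N ⊗≫ Uᘁ ◁ (β_ U N).hom ⊗≫ ((β_ N Uᘁ).inv ≫ (β_ N Uᘁ).hom) ▷ U ⊗≫
          Uᘁ ◁ (β_ N U).hom ⊗≫ ε_ U Uᘁ ▷ N ⊗≫ 𝟙 N := by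
      rw [Iso.inv_hom_id]; monoidal
    _ = 𝟙 N ⊗≫ coevL U ▷ N ⊗≫ Uᘁ ◁ (β_ U N).hom ⊗≫ (β_ N Uᘁ).inv ▷ U ⊗≫
          ((β_ N Uᘁ).hom ▷ U ⊗≫ Uᘁ ◁ (β_ N U).hom ⊗≫ ε_ U Uᘁ ▷ N ⊗≫ 𝟙 N) := by monoidal
    _ = _ := by rw [braiding_whiskerLeft_counit]; monoidal

theorem trHom_ringOver (U N : C) :
    trHom (ringOver U N) = trHom ((β_ U N).hom ≫ (β_ N U).hom) := by
  rw [trHom_tensor, ringOver_eq]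

/-- Here N slides over the coevaluation, and the double braiding is with U^∨. The trace is therefore
the Hopf link of N with U^∨, not with U. -/
theorem ringUnder_eq (U N : C) :
    ringUnder U N = 𝟙 N ⊗≫ N ◁ coevL U ⊗≫ ((β_ N Uᘁ).hom ≫ (β_ Uᘁ N).hom) ▷ U ⊗≫
      N ◁ ε_ U Uᘁ ⊗≫ 𝟙 N := by
  simp only [ringUnder, HB.closure, HB.over]
  calc
    _ = 𝟙 N ⊗≫ (𝟙 (N ⊗ 𝟙_ C) ⊗≫ coevL U ▷ N ⊗≫ 𝟙 (Uᘁ ⊗ U ⊗ N)) ⊗≫ Uᘁ ◁ (β_ N U).inv ⊗≫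
          (β_ Uᘁ N).hom ▷ U ⊗≫ N ◁ ε_ U Uᘁ ⊗≫ 𝟙 N := by monoidal
    _ = 𝟙 N ⊗≫ N ◁ coevL U ⊗≫ (β_ N Uᘁ).hom ▷ U ⊗≫ Uᘁ ◁ ((β_ N U).hom ≫ (β_ N U).inv) ⊗≫
          (β_ Uᘁ N).hom ▷ U ⊗≫ N ◁ ε_ U Uᘁ ⊗≫ 𝟙 N := by
      rw [← whiskerLeft_unit_braiding]; monoidal
    _ = _ := by rw [Iso.hom_inv_id]; monoidal

theorem trHom_ringUnder (U N : C) :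
    trHom (ringUnder U N) = trHom ((β_ N Uᘁ).hom ≫ (β_ Uᘁ N).hom) := by
  rw [(PivotalPair.codual U).trHom_tensor, ringUnder_eq]; rfl

theorem ringUnder_eq_loop (U N : C) :
    ringUnder U N = 𝟙 N ⊗≫ N ◁ coevL U ⊗≫ (β_ N Uᘁ).hom ▷ U ⊗≫ Uᘁ ◁ (β_ U N).inv ⊗≫
      ε_ U Uᘁ ▷ N ⊗≫ 𝟙 N := by
  symm
  calc
    _ = 𝟙 N ⊗≫ N ◁ coevL U ⊗≫ (β_ N Uᘁ).hom ▷ U ⊗≫ Uᘁ ◁ (β_ U N).inv ⊗≫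
      (𝟙 (Uᘁ ⊗ (U ⊗ N)) ⊗≫ ε_ U Uᘁ ▷ N ⊗≫ 𝟙 N) := by monoidal
    _ = 𝟙 N ⊗≫ N ◁ coevL U ⊗≫ (β_ N Uᘁ).hom ▷ U ⊗≫ Uᘁ ◁ ((β_ U N).inv ≫ (β_ U N).hom) ⊗≫
      (β_ Uᘁ N).hom ▷ U ⊗≫ N ◁ ε_ U Uᘁ ⊗≫ 𝟙 N := by
      rw [← braiding_whiskerRight_counit]; monoidal
    _ = _ := by rw [Iso.inv_hom_id, ringUnder_eq]; monoidal

/-- Both arcs of the loop pass over A, so A is not linked; B is passed over on one arc and under on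
the other. In `closure_overUnder_under` the roles are exchanged. -/
theorem closure_overUnder_over (U A B : C) :
    ((HB.over A).prod (HB.under B)).closure U (β_ U (A ⊗ B)).hom = A ◁ ringOver U B := by
  rw [ringOver, ← HB.closure_prod_left, hexagon_right]; rfl

theorem closure_overUnder_under (U A B : C) :
    ((HB.over A).prod (HB.under B)).closure U (β_ (A ⊗ B) U).inv = ringUnder U A ▷ B := by
  rw [ringUnder, ← HB.closure_prod_right, braiding_tensor_left_inv]
  congr 1
  simp only [HB.under]
  monoidal

/-- The crossing with A moves past a and becomes one with A' and N, while the returning strand moves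
past b. The loop then slides off A' and B, so it links only the exchanged strand N. -/
theorem closure_overUnder_channel (T : C) {A B A' B' N : C} (a : A ⟶ A' ⊗ N) (b : N ⊗ B ⟶ B') :
    ((HB.over A').prod (HB.under B')).closure T (((HB.over A).prod (HB.under B)).σ T ≫
        (a ▷ B ≫ (α_ A' N B).hom ≫ A' ◁ b) ▷ T) =
      a ▷ B ≫ (α_ A' N B).hom ≫ A' ◁ ringOver T N ▷ B ≫ A' ◁ b := by
  have h1 : ((HB.over A).prod (HB.under B)).σ T ≫ (a ▷ B ≫ (α_ A' N B).hom ≫ A' ◁ b) ▷ T =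
      T ◁ (a ▷ B ≫ (α_ A' N B).hom) ≫
        ((𝟙 _ ⊗≫ (HB.over A').σ T ▷ (N ⊗ B) ⊗≫ A' ◁ (𝟙 (T ⊗ N ⊗ B) ⊗≫ (β_ T N).hom ▷ B ⊗≫
          N ◁ (HB.under B).σ T ⊗≫ 𝟙 ((N ⊗ B) ⊗ T)) ⊗≫ 𝟙 _) ≫
          (A' ◁ b) ▷ T) := by
    simp only [HB.over, HB.under, HB.prod]
    calc
      _ = 𝟙 _ ⊗≫ (β_ T A).hom ▷ B ⊗≫ (A ◁ (β_ B T).inv ≫ a ▷ (B ⊗ T)) ⊗≫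
          A' ◁ b ▷ T ⊗≫ 𝟙 ((A' ⊗ B') ⊗ T) := by monoidal
      _ = 𝟙 _ ⊗≫ ((β_ T A).hom ≫ a ▷ T) ▷ B ⊗≫ (A' ⊗ N) ◁ (β_ B T).inv ⊗≫
          A' ◁ b ▷ T ⊗≫ 𝟙 ((A' ⊗ B') ⊗ T) := by rw [whisker_exchange]; monoidal
      _ = _ := by
        rw [← braiding_naturality_right, hexagon_right]; monoidal
  have h2 (U : C) : ((HB.under N).prod (HB.under B)).σ U = (HB.under (N ⊗ B)).σ U := by
    simp only [HB.under, HB.prod]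
    rw [braiding_tensor_left_inv]; monoidal
  rw [h1, HB.closure_comp_left, HB.closure_comp_right ((HB.over A').prod
    ((HB.under N).prod (HB.under B))), HB.closure_prod_left, HB.closure_prod_right, ringOver]
  · simp
  · calc
      _ = 𝟙 _ ⊗≫ (HB.over A').σ Tᘁ ▷ (N ⊗ B) ⊗≫ A' ◁ ((β_ (N ⊗ B) Tᘁ).inv ≫ b ▷ Tᘁ) ⊗≫ 𝟙 _ := by
        have h3 : ((HB.under N).prod (HB.under B)).σ Tᘁ = (β_ (N ⊗ B) Tᘁ).inv := h2 Tᘁ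
        rw [← h3]; simp only [HB.prod]; monoidal
      _ = 𝟙 _ ⊗≫ ((HB.over A').σ Tᘁ ▷ (N ⊗ B) ≫ (A' ⊗ Tᘁ) ◁ b) ⊗≫ A' ◁ (β_ B' Tᘁ).inv ⊗≫
          𝟙 _ := by
        rw [← braiding_inv_naturality_right]; monoidal
      _ = _ := by
        rw [← whisker_exchange]; simp only [HB.prod, HB.under]; monoidal

end Rings

/-! ### Linear traces, semisimplicity, dual bases and rotation -/

section Linear

open ExactPairing BraidedCategory

variable (k : Type w) [Field k] [IsAlgClosed k] {C : Type u} [Category.{v} C] [Abelian C]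
  [Linear k C] [MonoidalCategory C] [MonoidalPreadditive C] [MonoidalLinear k C]
  [BraidedCategory C] [RightRigidCategory C] [RibbonCategory C]

section Fusion

variable [FusionCategory k C]

theorem qtr_eq {X : C} (f : X ⟶ X) : qtr k f = unitScalar k (trHom f) := rfl

theorem qtr_smul_id {X : C} (f : X ⟶ X) : qtr k f • 𝟙 (𝟙_ C) = trHom f :=
  unitScalar_smul k _

theorem qtr_comm {X Y : C} (f : X ⟶ Y) (g : Y ⟶ X) : qtr k (f ≫ g) = qtr k (g ≫ f) := by
  rw [qtr_eq, qtr_eq, trHom_comm]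

/-- The quantum trace as a linear form. -/
def qtrₗ (X : C) : (X ⟶ X) →ₗ[k] k := tracePairing k X X (𝟙 X)

theorem qtrₗ_apply {X : C} (f : X ⟶ X) : qtrₗ k X f = qtr k f := by
  change qtr k (𝟙 X ≫ f) = qtr k f
  rw [Category.id_comp]

theorem tracePairing_apply {X Y : C} (f : X ⟶ Y) (g : Y ⟶ X) :
    tracePairing k X Y f g = qtr k (f ≫ g) := rfl

theorem qtr_smul {X : C} (c : k) (f : X ⟶ X) : qtr k (c • f) = c * qtr k f := by
  rw [← qtrₗ_apply, ← qtrₗ_apply, map_smul, smul_eq_mul]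

theorem qtr_sum {X : C} {α : Type*} (t : Finset α) (f : α → (X ⟶ X)) :
    qtr k (∑ a ∈ t, f a) = ∑ a ∈ t, qtr k (f a) := by
  simp only [← qtrₗ_apply, map_sum]

theorem qtr_smul_one {X : C} (c : k) : qtr k (c • 𝟙 X) = c * qdim k X := qtr_smul k c _

theorem coevL_evaluation (X : C) : coevL X ≫ ε_ X Xᘁ = qdim k X • 𝟙 (𝟙_ C) := by
  rw [qdim, qtr_smul_id, trHom_eq_left]; simp

theorem qdim_tensor (X Y : C) : qdim k (X ⊗ Y) = qdim k X * qdim k Y := by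
  rw [qdim, qtr_eq, trHom_tensor, ← qtr_smul_one, ← qtr_eq]
  congr 1
  calc
    _ = 𝟙 Y ⊗≫ (coevL X ≫ ε_ X Xᘁ) ▷ Y ⊗≫ 𝟙 Y := by monoidal
    _ = _ := by
      rw [coevL_evaluation k]
      simp [monoidalComp]

theorem qdim_dual (X : C) : qdim k Xᘁ = qdim k X := by
  rw [qdim, qtr_eq, trHom_dual, qdim, qtr_eq, trHom_eq_left]; simp

theorem qtr_iso {X Y : C} (i : X ≅ Y) (f : X ⟶ X) : qtr k (i.inv ≫ f ≫ i.hom) = qtr k f := by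
  rw [qtr_comm]; simp

theorem qdim_iso {X Y : C} (i : X ≅ Y) : qdim k X = qdim k Y := by
  rw [qdim, ← qtr_iso k i, Category.id_comp, i.inv_hom_id, qdim]

theorem closure_self_eq {Z : C} (h : HB Z) (U : C) : h.closure U (h.σ U) = qdim k U • 𝟙 Z := by
  rw [h.closure_self, coevL_evaluation k]
  simp [monoidalComp]

theorem sEntry_comm (X Y : C) : sEntry k X Y = sEntry k Y X := qtr_comm k _ _

theorem sEntry_iso_left {X X' : C} (i : X ≅ X') (Y : C) : sEntry k X Y = sEntry k X' Y := by
  have h : (β_ X' Y).hom ≫ (β_ Y X').hom =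
      i.inv ▷ Y ≫ ((β_ X Y).hom ≫ (β_ Y X).hom) ≫ i.hom ▷ Y := by
    rw [Category.assoc, ← braiding_naturality_right, ← braiding_naturality_left_assoc,
      ← comp_whiskerRight_assoc]
    simp
  rw [sEntry, sEntry, h]
  exact (qtr_iso k (whiskerRightIso i Y) _).symm

theorem qtr_ringOver (U N : C) : qtr k (ringOver U N) = sEntry k U N := by
  rw [qtr_eq, trHom_ringOver]; rfl

theorem qtr_ringUnder (U N : C) : qtr k (ringUnder U N) = sEntry k N Uᘁ := by
  rw [qtr_eq, trHom_ringUnder]; rfl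

instance (X Y : C) : FiniteDimensional k (X ⟶ Y) := FusionCategory.finiteDimensional_hom X Y

theorem eq_smul_id_of_simple (X : C) [Simple X] (f : X ⟶ X) : ∃ c : k, f = c • 𝟙 X := by
  obtain ⟨c, hc⟩ := endomorphism_simple_eq_smul_id k f
  exact ⟨c, hc.symm⟩

/-- Schur's lemma in a form without division, available before dimensions are known to be nonzero.
-/
theorem qdim_smul_eq (X : C) [Simple X] (f : X ⟶ X) : qdim k X • f = qtr k f • 𝟙 X := by
  obtain ⟨c, rfl⟩ := eq_smul_id_of_simple k X f
  rw [qtr_smul_one, smul_smul, mul_comm]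

theorem eq_smul_of_qdim_ne_zero (X : C) [Simple X] (h : qdim k X ≠ 0) (f : X ⟶ X) :
    f = (qtr k f / qdim k X) • 𝟙 X := by
  rw [div_eq_inv_mul, mul_smul, ← qdim_smul_eq, smul_smul, inv_mul_cancel₀ h, one_smul]

theorem sEntry_unit (X : C) : sEntry k X (𝟙_ C) = qdim k X := by
  rw [sEntry, braiding_tensorUnit_left, braiding_tensorUnit_right]
  simp only [Category.assoc, Iso.inv_hom_id_assoc, Iso.hom_inv_id]
  exact qdim_iso k (ρ_ X)

end Fusion

section Simples

variable [FusionCategory k C] {ι : Type*} {s : ι → C} (hs : IsCompleteSetOfSimples s)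
include hs

theorem IsCompleteSetOfSimples.hom_eq_zero {i j : ι} (h : i ≠ j) (f : s i ⟶ s j) : f = 0 := by
  by_contra hf
  have := hs.simple i
  have := hs.simple j
  have := isIso_of_hom_simple hf
  exact h (hs.eq_of_iso i j ⟨asIso f⟩)

include k

theorem IsCompleteSetOfSimples.exists_resolution (X : C) :
    ∃ (n : ℕ) (t : Fin n → ι) (p : ∀ a, X ⟶ s (t a)) (i : ∀ a, s (t a) ⟶ X),
      ∑ a, p a ≫ i a = 𝟙 X := by
  obtain ⟨n, Y, p, i, hY, -, -, h⟩ := FusionCategory.semisimple (k := k) X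
  choose t ht using fun a => hs.exists_iso (Y a) (hY a)
  refine ⟨n, t, fun a => p a ≫ (ht a).some.hom, fun a => (ht a).some.inv ≫ i a, ?_⟩
  simpa using h

theorem IsCompleteSetOfSimples.hom_ext_right {X Y : C} {f g : X ⟶ Y}
    (h : ∀ (t : ι) (p : Y ⟶ s t), f ≫ p = g ≫ p) : f = g := by
  obtain ⟨n, t, p, i, hp⟩ := IsCompleteSetOfSimples.exists_resolution k hs Y
  rw [← Category.comp_id f, ← Category.comp_id g, ← hp, Preadditive.comp_sum, Preadditive.comp_sum]
  exact Finset.sum_congr rfl fun a _ => by rw [← Category.assoc, h, Category.assoc]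

theorem IsCompleteSetOfSimples.hom_ext_left {X Y : C} {f g : X ⟶ Y}
    (h : ∀ (t : ι) (p : s t ⟶ X), p ≫ f = p ≫ g) : f = g := by
  obtain ⟨n, t, p, i, hp⟩ := IsCompleteSetOfSimples.exists_resolution k hs X
  rw [← Category.id_comp f, ← Category.id_comp g, ← hp, Preadditive.sum_comp, Preadditive.sum_comp]
  exact Finset.sum_congr rfl fun a _ => by rw [Category.assoc, h, Category.assoc]

variable (hd : ∀ i, qdim k (s i) ≠ 0)
include hd

/-- If f ≠ 0, some component p ≫ f ≫ p' between simples is invertible; the test morphism p' ≫ (p ≫ f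
≫ p')⁻¹ ≫ p has trace d(s t) ≠ 0. -/
theorem eq_zero_of_qtr_comp {X Y : C} (f : X ⟶ Y) (h : ∀ g : Y ⟶ X, qtr k (f ≫ g) = 0) :
    f = 0 := by
  refine IsCompleteSetOfSimples.hom_ext_left k hs fun t p =>
    IsCompleteSetOfSimples.hom_ext_right k hs fun t' p' => ?_
  by_contra hf
  rw [Limits.comp_zero, Limits.zero_comp] at hf
  have := hs.simple t
  have := hs.simple t'
  have := isIso_of_hom_simple hf
  apply hd t
  rw [← h (p' ≫ inv ((p ≫ f) ≫ p') ≫ p), qdim, ← IsIso.hom_inv_id ((p ≫ f) ≫ p'),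
    Category.assoc, Category.assoc, qtr_comm]
  simp

theorem isPerfPair_tracePairing (X Y : C) : (tracePairing k X Y).IsPerfPair := by
  refine LinearMap.IsPerfPair.of_injective ?_ ?_
  · rw [← LinearMap.ker_eq_bot, LinearMap.ker_eq_bot']
    intro f hf
    exact eq_zero_of_qtr_comp k hs hd f fun g => LinearMap.congr_fun hf g
  · rw [← LinearMap.ker_eq_bot, LinearMap.ker_eq_bot']
    intro f hf
    refine eq_zero_of_qtr_comp k hs hd f fun g => ?_
    rw [qtr_comm]
    exact LinearMap.congr_fun hf g

theorem exists_isDualFamily {X Y : C} {κ : Type*} (b : Module.Basis κ k (X ⟶ Y)) :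
    ∃ b' : κ → (Y ⟶ X), IsDualFamily k b b' := by
  have := isPerfPair_tracePairing k hs hd X Y
  refine ⟨fun j => (tracePairing k X Y).flip.toPerfPair.symm (b.coord j), fun i => ?_,
    fun i j h => ?_⟩
  · simp
  · simp [h]

omit hd in
theorem comp_of_isDualFamily {X : C} {t : ι} {κ : Type*} [DecidableEq κ]
    {c : κ → (X ⟶ s t)} {c' : κ → (s t ⟶ X)} (h : IsDualFamily k c c') (i j : κ) :
    qdim k (s t) • (c' j ≫ c i) = if i = j then 𝟙 (s t) else 0 := by
  have := hs.simple t
  rw [qdim_smul_eq, qtr_comm, ← tracePairing_apply]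
  split_ifs with hij
  · subst hij; rw [h.pairing_self, one_smul]
  · rw [h.pairing_ne i j hij, zero_smul]

variable [Fintype ι]

omit hs hd [Fintype ι] in
theorem IsDualFamily.symm {X Y : C} {κ : Type*} {b : κ → (X ⟶ Y)} {b' : κ → (Y ⟶ X)}
    (h : IsDualFamily k b b') : IsDualFamily k b' b where
  pairing_self i := by rw [tracePairing_apply, qtr_comm]; exact h.pairing_self i
  pairing_ne i j hij := by rw [tracePairing_apply, qtr_comm]; exact h.pairing_ne j i hij.symm

/-- The weight d(s t) compensates for dual vectors composing on s t to 1/d(s t), as the trace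
pairing dictates. It suffices to test against the basis vectors. -/
theorem sum_comp_isDualFamily {X : C} {κ : ι → Type*} [∀ t, Fintype (κ t)]
    (c : ∀ t, Module.Basis (κ t) k (X ⟶ s t)) (c' : ∀ t, κ t → (s t ⟶ X))
    (h : ∀ t, IsDualFamily k (c t) (c' t)) :
    ∑ t, qdim k (s t) • ∑ j, c t j ≫ c' t j = 𝟙 X := by
  classical
  refine IsCompleteSetOfSimples.hom_ext_right k hs fun t p => ?_
  rw [Category.id_comp]
  refine LinearMap.congr_fun
    (f := Linear.leftComp k (s t) (∑ t, qdim k (s t) • ∑ j, c t j ≫ c' t j))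
    (g := LinearMap.id) ((c t).ext fun i => ?_) p
  simp only [Linear.leftComp_apply, LinearMap.id_apply, Preadditive.sum_comp, Linear.smul_comp,
    Category.assoc]
  rw [Finset.sum_eq_single t]
  · rw [Finset.smul_sum]
    refine (Finset.sum_congr rfl fun j _ => ?_).trans
      (Finset.sum_ite_eq Finset.univ i fun j => c t j) |>.trans (by simp)
    rw [← Linear.comp_smul, comp_of_isDualFamily k hs (h t)]
    split_ifs with hij <;> simp
  · intro t' _ ht
    simp [hs.hom_eq_zero ht]
  · simp

theorem sum_isDualFamily_comp {X : C} {κ : ι → Type*} [∀ t, Fintype (κ t)]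
    (b : ∀ t, Module.Basis (κ t) k (s t ⟶ X)) (b' : ∀ t, κ t → (X ⟶ s t))
    (h : ∀ t, IsDualFamily k (b t) (b' t)) :
    ∑ t, qdim k (s t) • ∑ j, b' t j ≫ b t j = 𝟙 X := by
  classical
  refine IsCompleteSetOfSimples.hom_ext_left k hs fun t p => ?_
  rw [Category.comp_id]
  refine LinearMap.congr_fun
    (f := Linear.rightComp k (s t) (∑ t, qdim k (s t) • ∑ j, b' t j ≫ b t j))
    (g := LinearMap.id) ((b t).ext fun i => ?_) p
  simp only [Linear.rightComp_apply, LinearMap.id_apply, Preadditive.comp_sum, Linear.comp_smul]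
  rw [Finset.sum_eq_single t]
  · rw [Finset.smul_sum]
    refine (Finset.sum_congr rfl fun j _ => ?_).trans
      (Finset.sum_ite_eq Finset.univ i fun j => b t j) |>.trans (by simp)
    rw [← Category.assoc, ← Linear.smul_comp,
      comp_of_isDualFamily k hs (IsDualFamily.symm k (h t))]
    by_cases hij : i = j
    · subst hij; simp
    · simp [hij, Ne.symm hij]
  · intro t' _ ht
    simp [← Category.assoc, hs.hom_eq_zero ht.symm]
  · simp

end Simples

section Rotation

variable [FusionCategory k C]

/-- Rotation of the strand `Y` from the target to the source. -/
def PivotalPair.rot {Y Y' : C} (P : PivotalPair Y Y') (S A : C) :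
    (S ⟶ A ⊗ Y) ≃ₗ[k] (S ⊗ Y' ⟶ A) where
  toFun b := b ▷ Y' ≫ (α_ A Y Y').hom ≫ A ◁ P.e ≫ (ρ_ A).hom
  invFun g := (ρ_ S).inv ≫ S ◁ P.m ≫ (α_ S Y' Y).inv ≫ g ▷ Y
  map_add' b b' := by simp
  map_smul' c b := by simp
  left_inv b := by
    calc
      _ = 𝟙 _ ⊗≫ (S ◁ P.m ≫ b ▷ (Y' ⊗ Y)) ⊗≫ A ◁ P.e ▷ Y ⊗≫ 𝟙 _ := by monoidal
      _ = 𝟙 _ ⊗≫ b ⊗≫ A ◁ (Y ◁ P.m ⊗≫ P.e ▷ Y) ⊗≫ 𝟙 _ := by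
        rw [whisker_exchange]; monoidal
      _ = _ := by rw [P.snake_e_m]; monoidal
  right_inv g := by
    calc
      _ = 𝟙 _ ⊗≫ S ◁ P.m ▷ Y' ⊗≫ (g ▷ (Y ⊗ Y') ≫ A ◁ P.e) ⊗≫ 𝟙 _ := by monoidal
      _ = 𝟙 _ ⊗≫ S ◁ (P.m ▷ Y' ⊗≫ Y' ◁ P.e) ⊗≫ g ⊗≫ 𝟙 _ := by
        rw [← whisker_exchange]; monoidal
      _ = _ := by rw [P.snake_m_e]; monoidal

/-- Rotation of the strand `Y` from the source to the target. -/
def PivotalPair.corot {Y Y' : C} (P : PivotalPair Y Y') {S A : C} (g : A ⊗ Y ⟶ S) :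
    A ⟶ S ⊗ Y' :=
  (ρ_ A).inv ≫ A ◁ P.n ≫ (α_ A Y Y').inv ≫ g ▷ Y'

/-- Both traces are the same closed diagram, read with Y closed first. Hence rotation carries dual
bases to dual bases. -/
theorem PivotalPair.qtr_rot_corot {Y Y' : C} (P : PivotalPair Y Y') {S A : C} (b : S ⟶ A ⊗ Y)
    (g : A ⊗ Y ⟶ S) : qtr k (P.rot k S A b ≫ P.corot g) = qtr k (b ≫ g) := by
  rw [qtr_comm, qtr_comm k b, qtr_eq, qtr_eq, P.trHom_tensor]
  congr 2
  simp only [corot, rot, LinearEquiv.coe_mk, LinearMap.coe_mk, AddHom.coe_mk]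
  monoidal

theorem PivotalPair.isDualFamily_rot {Y Y' : C} (P : PivotalPair Y Y') {S A : C} {κ : Type*}
    {b : Module.Basis κ k (S ⟶ A ⊗ Y)} {b' : κ → (A ⊗ Y ⟶ S)} (h : IsDualFamily k b b') :
    IsDualFamily k (b.map (P.rot k S A)) fun j => P.corot (b' j) where
  pairing_self i := by
    rw [tracePairing_apply, Module.Basis.map_apply, qtr_rot_corot]; exact h.pairing_self i
  pairing_ne i j hij := by
    rw [tracePairing_apply, Module.Basis.map_apply, qtr_rot_corot]; exact h.pairing_ne i j hij

end Rotation

end Linear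

/-! ### The Kirby sum and the invertibility of S -/

section Kill

open ExactPairing BraidedCategory

variable (k : Type w) [Field k] [IsAlgClosed k] {C : Type u} [Category.{v} C] [Abelian C]
  [Linear k C] [MonoidalCategory C] [MonoidalPreadditive C] [MonoidalLinear k C]
  [BraidedCategory C] [RightRigidCategory C] [RibbonCategory C]

/-- By the hexagons and cyclicity, U rings N inside the link of T with N; closing U first produces
the scalar. -/
theorem sEntry_tensor [FusionCategory k C] {U T N : C} {c : k} (hc : ringOver U N = c • 𝟙 N) :
    sEntry k (U ⊗ T) N = c * sEntry k T N := by
  have h1 : sEntry k (U ⊗ T) N = qtr k (U ◁ ((β_ N T).hom ≫ (β_ T N).hom) ≫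
      (α_ U N T).inv ≫ ((β_ U N).hom ≫ (β_ N U).hom) ▷ T ≫ (α_ U N T).hom) := by
    rw [sEntry, ← qtr_iso k (α_ U T N)]
    refine Eq.trans ?_ (qtr_comm k (U ◁ (β_ T N).hom ≫ (α_ U N T).inv ≫
      ((β_ U N).hom ≫ (β_ N U).hom) ▷ T ≫ (α_ U N T).hom) (U ◁ (β_ N T).hom)) |>.trans ?_
    · rw [hexagon_left, hexagon_right]
      congr 1
      monoidal
    · simp
  rw [h1, qtr_eq, trHom_tensor, sEntry_comm k T N, sEntry, ← qtr_smul, ← qtr_eq]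
  congr 1
  calc
    _ = 𝟙 _ ⊗≫ (coevL U ▷ (N ⊗ T) ≫ (Uᘁ ⊗ U) ◁ ((β_ N T).hom ≫ (β_ T N).hom)) ⊗≫
        Uᘁ ◁ ((β_ U N).hom ≫ (β_ N U).hom) ▷ T ⊗≫ ε_ U Uᘁ ▷ N ▷ T ⊗≫ 𝟙 _ := by monoidal
    _ = ((β_ N T).hom ≫ (β_ T N).hom) ≫ (𝟙 N ⊗≫ coevL U ▷ N ⊗≫
        Uᘁ ◁ ((β_ U N).hom ≫ (β_ N U).hom) ⊗≫ ε_ U Uᘁ ▷ N ⊗≫ 𝟙 N) ▷ T := by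
      rw [← whisker_exchange]; monoidal
    _ = _ := by rw [← ringOver_eq, hc]; simp

section Fusion

variable [FusionCategory k C] {ι : Type*} {s : ι → C} (hs : IsCompleteSetOfSimples s)
  (hd : ∀ i, qdim k (s i) ≠ 0) [Fintype ι]
include hs hd

theorem sEntry_eq_sum (X N : C) :
    sEntry k X N = ∑ t, (Module.finrank k (X ⟶ s t) : k) * sEntry k (s t) N := by
  choose c' hc' using fun t => exists_isDualFamily k hs hd (Module.finBasis k (X ⟶ s t))
  have h1 : (𝟙 X ▷ N) ≫ (β_ X N).hom ≫ (β_ N X).hom = (β_ X N).hom ≫ (β_ N X).hom := by simp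
  rw [sEntry, ← h1, ← sum_comp_isDualFamily k hs hd _ c' hc', sum_whiskerRight,
    Preadditive.sum_comp, qtr_sum]
  refine Finset.sum_congr rfl fun t _ => ?_
  rw [Finset.smul_sum, sum_whiskerRight, Preadditive.sum_comp, qtr_sum]
  refine (Finset.sum_congr rfl fun j _ => ?_).trans (b := ∑ j, sEntry k (s t) N) (by simp)
  have h2 := comp_of_isDualFamily k hs (hc' t) j j
  rw [if_pos rfl] at h2
  rw [MonoidalLinear.smul_whiskerRight, comp_whiskerRight, Linear.smul_comp, Category.assoc,
    braiding_naturality_left_assoc, braiding_naturality_right, qtr_smul, ← Category.assoc,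
    ← Category.assoc, qtr_comm, ← qtr_smul]
  rw [← Category.assoc, ← Category.assoc, ← comp_whiskerRight, Category.assoc, ← Linear.smul_comp,
    ← MonoidalLinear.smul_whiskerRight, h2]
  simp [sEntry]

theorem qdim_eq_sum (X : C) :
    qdim k X = ∑ t, (Module.finrank k (X ⟶ s t) : k) * qdim k (s t) := by
  simpa only [sEntry_unit] using sEntry_eq_sum k hs hd X (𝟙_ C)

omit [Fintype ι] in
theorem finrank_hom_comm (X Y : C) : Module.finrank k (X ⟶ Y) = Module.finrank k (Y ⟶ X) := by
  have := isPerfPair_tracePairing k hs hd X Y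
  exact Module.finrank_of_isPerfPair (tracePairing k X Y)

/-- The vector of dimensions is an eigenvector of the fusion matrices: by Frobenius reciprocity the
sum computes d(V ⊗ U^∨). -/
theorem sum_qdim_finrank_tensor (U V : C) :
    ∑ t, qdim k (s t) * (Module.finrank k (s t ⊗ U ⟶ V) : k) = qdim k U * qdim k V := by
  rw [← qdim_dual k U, mul_comm, ← qdim_tensor, qdim_eq_sum k hs hd]
  refine Finset.sum_congr rfl fun t _ => ?_
  rw [← ((PivotalPair.codual U).rot k (s t) V).finrank_eq, finrank_hom_comm k hs hd, mul_comm]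

/-- Bending both strands identifies Hom(T^∨, V) with Hom(V^∨, T), so no permutation T ↦ T^∨ of the
simples has to be chosen. -/
theorem sum_qdim_finrank_dual (V : C) :
    ∑ t, qdim k (s t) * (Module.finrank k ((s t)ᘁ ⟶ V) : k) = qdim k V := by
  rw [← qdim_dual k V, qdim_eq_sum k hs hd]
  refine Finset.sum_congr rfl fun t _ => ?_
  rw [mul_comm, ← (Linear.homCongr k (λ_ (s t)ᘁ) (Iso.refl V)).finrank_eq,
    ← ((PivotalPair.dual (s t)).rot k (𝟙_ C) V).finrank_eq,
    (Linear.homCongr k (Iso.refl (𝟙_ C)) (β_ V (s t))).finrank_eq,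
    ((PivotalPair.dual V).rot k (𝟙_ C) (s t)).finrank_eq,
    (Linear.homCongr k (λ_ Vᘁ) (Iso.refl (s t))).finrank_eq]

theorem sum_qdim_sEntry_dual (N : C) :
    ∑ t, qdim k (s t) * sEntry k (s t)ᘁ N = ∑ t, qdim k (s t) * sEntry k (s t) N := by
  simp_rw [sEntry_eq_sum k hs hd (_ᘁ) N, Finset.mul_sum]
  rw [Finset.sum_comm]
  refine Finset.sum_congr rfl fun v _ => ?_
  simp_rw [← mul_assoc]
  rw [← Finset.sum_mul, sum_qdim_finrank_dual k hs hd]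

/-- Σ d(T) S_{T ⊗ U, N} is evaluated by nesting rings and by fusing T ⊗ U. So U acts on N by d(U)
unless the Kirby sum at N vanishes. -/
theorem ring_mul_sum_qdim_sEntry {U N : C} {c : k} (hc : ringOver U N = c • 𝟙 N) :
    c * ∑ t, qdim k (s t) * sEntry k (s t) N =
      qdim k U * ∑ t, qdim k (s t) * sEntry k (s t) N := by
  calc
    _ = ∑ t, qdim k (s t) * sEntry k (s t ⊗ U) N := by
      rw [Finset.mul_sum]
      refine Finset.sum_congr rfl fun t _ => ?_
      rw [sEntry_iso_left k (β_ (s t) U), sEntry_tensor k hc]; ring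
    _ = ∑ v, (∑ t, qdim k (s t) * (Module.finrank k (s t ⊗ U ⟶ s v) : k)) * sEntry k (s v) N := by
      simp_rw [sEntry_eq_sum k hs hd (_ ⊗ U) N, Finset.mul_sum, Finset.sum_mul]
      rw [Finset.sum_comm]
      simp_rw [mul_assoc]
    _ = _ := by
      simp_rw [sum_qdim_finrank_tensor k hs hd, mul_assoc]
      rw [Finset.mul_sum]

end Fusion

section Modular

variable [ModularTensorCategory k C] {ι : Type*} {s : ι → C} (hs : IsCompleteSetOfSimples s)
  [Fintype ι]
include hs

theorem eq_zero_of_sum_mul_sEntry (v : ι → k)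
    (hv : ∀ j, ∑ i, v i * sEntry k (s i) (s j) = 0) : v = 0 := by
  let e := Fintype.equivFin ι
  have h := ModularTensorCategory.isUnit_det_sMatrix (k := k) _ (s ∘ e.symm)
    ⟨fun i => hs.simple _, fun i j hij => e.symm.injective (hs.eq_of_iso _ _ hij), fun X hX => by
      obtain ⟨i, hi⟩ := hs.exists_iso X hX
      exact ⟨e i, by simpa using hi⟩⟩
  have h2 : v ∘ e.symm = 0 := by
    refine Matrix.eq_zero_of_vecMul_eq_zero h.ne_zero ?_
    ext j
    simp only [Matrix.vecMul, dotProduct, Matrix.of_apply, Function.comp_apply, Pi.zero_apply]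
    rw [← hv (e.symm j), ← e.symm.sum_comp]
  ext i
  simpa using congr_fun h2 (e i)

/-- Each S_{j,i} is the trace of a scalar on s i, hence a multiple of d(s i); if that were zero, S
would have a zero row. -/
theorem qdim_ne_zero (i : ι) : qdim k (s i) ≠ 0 := by
  classical
  intro h0
  have := hs.simple i
  have h : (Pi.single i 1 : ι → k) = 0 := by
    refine eq_zero_of_sum_mul_sEntry k hs _ fun j => ?_
    rw [Finset.sum_eq_single i (by intro b _ hb; simp [hb]) (by simp)]
    obtain ⟨c, hc⟩ := eq_smul_id_of_simple k (s i) (ringOver (s j) (s i))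
    rw [sEntry_comm, ← qtr_ringOver, hc, qtr_smul_one, h0]
    simp
  simpa using congr_fun h i

theorem sum_qdim_sEntry_of_iso {N : C} (e : 𝟙_ C ≅ N) :
    ∑ t, qdim k (s t) * sEntry k (s t) N = globalDim k s := by
  refine Finset.sum_congr rfl fun t _ => ?_
  rw [sEntry_comm, ← sEntry_iso_left k e, sEntry_comm, sEntry_unit, sq]

/-- Otherwise every ring acts on N by its dimension, which makes the row of N in S equal to d(N)
times the row of the unit. -/
theorem sum_qdim_sEntry_eq_zero {N : C} [Simple N] (hN : IsEmpty (𝟙_ C ≅ N)) :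
    ∑ t, qdim k (s t) * sEntry k (s t) N = 0 := by
  classical
  by_contra hK
  obtain ⟨i₀, ⟨e₀⟩⟩ := hs.exists_iso (𝟙_ C) (FusionCategory.simple_unit (k := k))
  obtain ⟨j, ⟨e⟩⟩ := hs.exists_iso N inferInstance
  have hj : j ≠ i₀ := by
    rintro rfl
    exact hN.false (e₀ ≪≫ e.symm)
  have h1 (U : C) : sEntry k U N = qdim k N * qdim k U := by
    obtain ⟨c, hc⟩ := eq_smul_id_of_simple k N (ringOver U N)
    rw [← qtr_ringOver, hc, qtr_smul_one, mul_right_cancel₀ hK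
      (ring_mul_sum_qdim_sEntry k hs (qdim_ne_zero k hs) hc), mul_comm]
  have h2 : (Pi.single j 1 - Pi.single i₀ (qdim k N) : ι → k) = 0 := by
    refine eq_zero_of_sum_mul_sEntry k hs _ fun t => ?_
    simp only [Pi.sub_apply, sub_mul, Finset.sum_sub_distrib]
    rw [Finset.sum_eq_single j (by intro b _ hb; simp [hb]) (by simp),
      Finset.sum_eq_single i₀ (by intro b _ hb; simp [hb]) (by simp), Pi.single_eq_same,
      Pi.single_eq_same, ← sEntry_iso_left k e, ← sEntry_iso_left k e₀, sEntry_comm k N,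
      sEntry_comm k (𝟙_ C), sEntry_unit, h1]
    ring
  have h3 := congr_fun h2 j
  simp [hj] at h3

/-- If d(C) = 0, all Kirby sums vanish and S kills the nonzero vector of dimensions. -/
theorem globalDim_ne_zero : globalDim k s ≠ 0 := by
  intro h0
  obtain ⟨i₀, -⟩ := hs.exists_iso (𝟙_ C) (FusionCategory.simple_unit (k := k))
  refine qdim_ne_zero k hs i₀ (congr_fun (eq_zero_of_sum_mul_sEntry k hs (fun i => qdim k (s i))
    fun j => ?_) i₀)
  have := hs.simple j
  by_cases h : Nonempty (𝟙_ C ≅ s j)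
  · rw [sum_qdim_sEntry_of_iso k hs h.some, h0]
  · exact sum_qdim_sEntry_eq_zero k hs (not_nonempty_iff.mp h)

end Modular

end Kill

/-! ### The inclusion of C in the tube category and the unwinding map -/

section TubeLayer

variable (k : Type w) [Field k] {C : Type u} [Category.{v} C] [Preadditive C]
  [Linear k C] [MonoidalCategory C] [MonoidalPreadditive C] [MonoidalLinear k C]

theorem annular_comp {X Y Z : C} (G H : C) (f : G ⊗ X ⟶ Y ⊗ G) (g : H ⊗ Y ⟶ Z ⊗ H) :
    annular k G f ≫ annular k H g = annular k (H ⊗ G) (stack G H f g) :=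
  tubeComp_mk G H f g

theorem annular_slide {X Y G H : C} (u : G ⟶ H) (f : H ⊗ X ⟶ Y ⊗ G) :
    annular k G (u ▷ X ≫ f) = annular k H (f ≫ Y ◁ u) :=
  tubeMk_slide u f

theorem annular_smul {X Y : C} (G : C) (c : k) (f : G ⊗ X ⟶ Y ⊗ G) :
    annular k G (c • f) = c • annular k G f :=
  map_smul (tubeMk k G) c f

theorem annular_sum {X Y : C} (G : C) {α : Type*} (t : Finset α) (f : α → (G ⊗ X ⟶ Y ⊗ G)) :
    annular k G (∑ a ∈ t, f a) = ∑ a ∈ t, annular k G (f a) :=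
  map_sum (tubeMk k G) f t

theorem annular_zero {X Y : C} (G : C) : annular k G (0 : G ⊗ X ⟶ Y ⊗ G) = 0 :=
  map_zero (tubeMk k G)

/-- The inclusion of `C` into the tube category. -/
def emb {X Y : C} (m : X ⟶ Y) : (⟨X⟩ : TubeCategory k C) ⟶ (⟨Y⟩ : TubeCategory k C) :=
  annular k (𝟙_ C) ((λ_ X).hom ≫ m ≫ (ρ_ Y).inv)

theorem emb_id (X : C) : emb k (𝟙 X) = 𝟙 (⟨X⟩ : TubeCategory k C) := by
  rw [emb, Category.id_comp]; rfl

theorem emb_comp_annular {X Y Z : C} (m : X ⟶ Y) (G : C) (f : G ⊗ Y ⟶ Z ⊗ G) :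
    emb k m ≫ annular k G f = annular k G (G ◁ m ≫ f) := by
  rw [emb, annular_comp]
  have h1 : stack (𝟙_ C) G ((λ_ X).hom ≫ m ≫ (ρ_ Y).inv) f =
      (ρ_ G).hom ▷ X ≫ ((G ◁ m ≫ f) ≫ Z ◁ (ρ_ G).inv) := by
    simp [stack]
  rw [h1, annular_slide]
  simp

theorem annular_comp_emb {X Y Z : C} (m : Y ⟶ Z) (G : C) (f : G ⊗ X ⟶ Y ⊗ G) :
    annular k G f ≫ emb k m = annular k G (f ≫ m ▷ G) := by
  rw [emb, annular_comp]
  have h1 : stack G (𝟙_ C) f ((λ_ Y).hom ≫ m ≫ (ρ_ Z).inv) =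
      (λ_ G).hom ▷ X ≫ ((f ≫ m ▷ G) ≫ Z ◁ (λ_ G).inv) := by
    simp [stack]
  rw [h1, annular_slide]
  simp

theorem emb_comp {X Y Z : C} (m : X ⟶ Y) (n : Y ⟶ Z) : emb k (m ≫ n) = emb k m ≫ emb k n := by
  rw [emb, emb, annular_comp_emb]; simp

theorem emb_smul {X Y : C} (c : k) (m : X ⟶ Y) : emb k (c • m) = c • emb k m := by
  simp only [emb, ← annular_smul, Linear.smul_comp, Linear.comp_smul]

theorem emb_sum {X Y : C} {α : Type*} (t : Finset α) (f : α → (X ⟶ Y)) :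
    emb k (∑ a ∈ t, f a) = ∑ a ∈ t, emb k (f a) := by
  simp only [emb, ← annular_sum, Preadditive.sum_comp, Preadditive.comp_sum]

theorem annular_induction {X Y : C} {P : ((⟨X⟩ : TubeCategory k C) ⟶ ⟨Y⟩) → Prop}
    (x : (⟨X⟩ : TubeCategory k C) ⟶ ⟨Y⟩)
    (h0 : P 0) (hadd : ∀ a b, P a → P b → P (a + b))
    (hmk : ∀ (G : C) (f : G ⊗ X ⟶ Y ⊗ G), P (annular k G f)) : P x :=
  tubeHom_induction x h0 hadd hmk

variable [BraidedCategory C] [RightRigidCategory C] [RibbonCategory C]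

open ExactPairing

/-- Closing annular diagrams across a half braiding, as a linear map on the tube category. -/
def HB.unwind {Z : C} (h : HB Z) (Y : C) :
    ((⟨Y⟩ : TubeCategory k C) ⟶ ⟨Z⟩) →ₗ[k] (Y ⟶ Z) :=
  tubeLift (k := k) (X := Y) (Y := Z)
    (fun G =>
      { toFun := h.closure G
        map_add' := fun f g => by simp [HB.closure, monoidalComp]
        map_smul' := fun c f => by simp [HB.closure, monoidalComp] })
    (fun _ _ u f => h.closure_slide u f)

theorem HB.unwind_annular {Z Y : C} (h : HB Z) (G : C) (f : G ⊗ Y ⟶ Z ⊗ G) :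
    h.unwind k Y (annular k G f) = h.closure G f :=
  tubeLift_mk _ _ G f

/-- Pushing a closed strand into a half braiding. -/
theorem HB.whiskerLeft_closure {Z Y : C} (h : HB Z) (T G : C) (f : G ⊗ Y ⟶ Z ⊗ G) :
    T ◁ h.closure G f ≫ h.σ T =
      (𝟙 (T ⊗ Y) ⊗≫ T ◁ coevL G ▷ Y ⊗≫ T ◁ Gᘁ ◁ f ⊗≫ 𝟙 (((T ⊗ Gᘁ) ⊗ Z) ⊗ G)) ≫
        h.σ (T ⊗ Gᘁ) ▷ G ≫ (𝟙 ((Z ⊗ (T ⊗ Gᘁ)) ⊗ G) ⊗≫ Z ◁ T ◁ ε_ G Gᘁ ⊗≫ 𝟙 (Z ⊗ T)) := by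
  simp only [HB.closure]
  calc
    _ = 𝟙 (T ⊗ Y) ⊗≫ T ◁ coevL G ▷ Y ⊗≫ T ◁ Gᘁ ◁ f ⊗≫ T ◁ h.σ Gᘁ ▷ G ⊗≫
        ((T ⊗ Z) ◁ ε_ G Gᘁ ≫ h.σ T ▷ 𝟙_ C) ⊗≫ 𝟙 (Z ⊗ T) := by monoidal
    _ = _ := by rw [whisker_exchange, h.tensor]; monoidal

/-- The map b' ≫ b lets the crossing by T ⊗ G^∨ be done by V instead; bending G then exposes the
rotated b at the end, ready to slide around the cylinder. -/
theorem HB.closure_rotation {Z Y : C} (h : HB Z) (T V G : C) (f : G ⊗ Y ⟶ Z ⊗ G)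
    (b : V ⟶ T ⊗ Gᘁ) (b' : T ⊗ Gᘁ ⟶ V) :
    (𝟙 (T ⊗ Y) ⊗≫ T ◁ coevL G ▷ Y ⊗≫ T ◁ Gᘁ ◁ f ⊗≫ 𝟙 (((T ⊗ Gᘁ) ⊗ Z) ⊗ G)) ≫
        (h.σ (T ⊗ Gᘁ) ≫ Z ◁ (b' ≫ b)) ▷ G ≫
          (𝟙 ((Z ⊗ (T ⊗ Gᘁ)) ⊗ G) ⊗≫ Z ◁ T ◁ ε_ G Gᘁ ⊗≫ 𝟙 (Z ⊗ T)) =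
      ((PivotalPair.codual G).corot b' ▷ Y ≫ stack G V f (h.σ V)) ≫
        Z ◁ (b ▷ G ≫ (α_ T Gᘁ G).hom ≫ T ◁ ε_ G Gᘁ ≫ (ρ_ T).hom) := by
  rw [whiskerLeft_comp, ← Category.assoc (h.σ _), ← h.nat]
  calc
    _ = 𝟙 (T ⊗ Y) ⊗≫ T ◁ coevL G ▷ Y ⊗≫ ((T ⊗ Gᘁ) ◁ f ≫ b' ▷ (Z ⊗ G)) ⊗≫ h.σ V ▷ G ⊗≫
          Z ◁ b ▷ G ⊗≫ Z ◁ T ◁ ε_ G Gᘁ ⊗≫ 𝟙 (Z ⊗ T) := by monoidal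
    _ = _ := by
      rw [whisker_exchange]
      simp only [PivotalPair.corot, PivotalPair.codual, stack]
      monoidal

end TubeLayer

/-! ### The handle slide: absorption into a Kirby-coloured loop -/

section Absorption

open ExactPairing

variable (k : Type w) [Field k] [IsAlgClosed k] {C : Type u} [Category.{v} C] [Abelian C]
  [Linear k C] [MonoidalCategory C] [MonoidalPreadditive C] [MonoidalLinear k C]
  [BraidedCategory C] [RightRigidCategory C] [RibbonCategory C] [FusionCategory k C]
  {ι : Type*} [Fintype ι] (s : ι → C)

/-- The Kirby-coloured strand running around the cylinder, crossing `Z` by its half braiding. -/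
def HB.loop {Z : C} (h : HB Z) : (⟨Z⟩ : TubeCategory k C) ⟶ ⟨Z⟩ :=
  ∑ t, qdim k (s t) • annular k (s t) (h.σ (s t))

theorem HB.emb_comp_loop {Z Y : C} (h : HB Z) (m : Y ⟶ Z) :
    emb k m ≫ h.loop k s = ∑ t, qdim k (s t) • annular k (s t) (s t ◁ m ≫ h.σ (s t)) := by
  simp only [HB.loop, Preadditive.comp_sum, Linear.comp_smul, emb_comp_annular]

theorem HB.unwind_emb_comp_loop {Z Y : C} (h : HB Z) (m : Y ⟶ Z) :
    h.unwind k Y (emb k m ≫ h.loop k s) = globalDim k s • m := by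
  rw [h.emb_comp_loop k s, map_sum, globalDim, Finset.sum_smul]
  refine Finset.sum_congr rfl fun t _ => ?_
  rw [map_smul, h.unwind_annular k, h.closure_comp_left, closure_self_eq k, Linear.comp_smul,
    Category.comp_id, smul_smul, sq]

variable {s} (hs : IsCompleteSetOfSimples s) (hd : ∀ i, qdim k (s i) ≠ 0)
include hs hd

theorem HB.annular_whiskerLeft_closure {Z Y : C} (h : HB Z) (T G : C) (f : G ⊗ Y ⟶ Z ⊗ G)
    {κ : ι → Type*} [∀ t, Fintype (κ t)] (b : ∀ v, Module.Basis (κ v) k (s v ⟶ T ⊗ Gᘁ))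
    (b' : ∀ v, κ v → (T ⊗ Gᘁ ⟶ s v)) (hb : ∀ v, IsDualFamily k (b v) (b' v)) :
    annular k T (T ◁ h.closure G f ≫ h.σ T) = ∑ v, qdim k (s v) • ∑ j,
      annular k (s v ⊗ G) (((PivotalPair.codual G).rot k (s v) T (b v j) ≫
        (PivotalPair.codual G).corot (b' v j)) ▷ Y ≫ stack G (s v) f (h.σ (s v))) := by
  have h1 : h.σ (T ⊗ Gᘁ) ▷ G =
      ∑ v, qdim k (s v) • ∑ j, (h.σ (T ⊗ Gᘁ) ≫ Z ◁ (b' v j ≫ b v j)) ▷ G := by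
    conv_lhs => rw [← Category.comp_id (h.σ (T ⊗ Gᘁ)), ← whiskerLeft_id,
      ← sum_isDualFamily_comp k hs hd b b' hb]
    simp only [whiskerLeft_sum, Preadditive.comp_sum, sum_whiskerRight,
      MonoidalLinear.whiskerLeft_smul, Linear.comp_smul, MonoidalLinear.smul_whiskerRight]
  rw [h.whiskerLeft_closure, h1]
  simp only [Preadditive.comp_sum, Preadditive.sum_comp, Linear.comp_smul, Linear.smul_comp,
    h.closure_rotation, annular_sum, annular_smul]
  refine Finset.sum_congr rfl fun v _ => congrArg _ (Finset.sum_congr rfl fun j _ => ?_)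
  rw [comp_whiskerRight _ ((PivotalPair.codual G).corot (b' v j)) Y,
    Category.assoc (_ ▷ Y) ((PivotalPair.codual G).corot (b' v j) ▷ Y), annular_slide]
  rfl

/-- Both sides expand to one double sum over simples v and t with weight d(v) d(t): the left by
resolving s v ⊗ G over t, the right by resolving s t ⊗ G^∨ over v. Rotation of G matches the dual
bases. -/
theorem HB.comp_loop {Z Y : C} (h : HB Z) (x : (⟨Y⟩ : TubeCategory k C) ⟶ ⟨Z⟩) :
    x ≫ h.loop k s = emb k (h.unwind k Y x) ≫ h.loop k s := by
  refine annular_induction k (P := fun x => x ≫ h.loop k s = emb k (h.unwind k Y x) ≫ h.loop k s)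
    x ?_ (fun a b ha hb => ?_) fun G f => ?_
  · simp [emb, annular_zero]
  · rw [Preadditive.add_comp, ha, hb, map_add, ← Preadditive.add_comp]
    congr 1
    simp [emb, annular]
  choose b' hb using fun t v =>
    exists_isDualFamily k hs hd (Module.finBasis k (s v ⟶ s t ⊗ Gᘁ))
  rw [h.unwind_annular k, h.emb_comp_loop k s]
  simp only [fun t => h.annular_whiskerLeft_closure k hs hd (s t) G f _ (b' t) (hb t)]
  simp only [Finset.smul_sum]
  rw [Finset.sum_comm]
  simp only [loop, Preadditive.comp_sum, Linear.comp_smul, annular_comp]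
  refine Finset.sum_congr rfl fun v _ => ?_
  -- The rotated bases resolve the identity of `s v ⊗ G`, which is then inserted below the stacked
  -- diagram.
  have h2 := sum_comp_isDualFamily k hs hd
    (fun t => (Module.finBasis k (s v ⟶ s t ⊗ Gᘁ)).map
      ((PivotalPair.codual G).rot k (s v) (s t)))
    _ fun t => (PivotalPair.codual G).isDualFamily_rot k (hb t v)
  have h3 : stack G (s v) f (h.σ (s v)) = 𝟙 (s v ⊗ G) ▷ Y ≫ stack G (s v) f (h.σ (s v)) := by simp
  conv_lhs => rw [h3, ← h2]
  simp only [Finset.smul_sum, sum_whiskerRight, MonoidalLinear.smul_whiskerRight,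
    Preadditive.sum_comp, Linear.smul_comp, annular_sum, annular_smul]
  refine Finset.sum_congr rfl fun t _ => Finset.sum_congr rfl fun j _ => ?_
  rw [smul_comm]
  rfl

end Absorption

/-! ### Completeness: the ε(S, A, B) add up to the identity -/

section Completeness

open ExactPairing BraidedCategory

theorem PivotalPair.corot_inv {C : Type u} [Category.{v} C] [MonoidalCategory C]
    [BraidedCategory C] [RightRigidCategory C] [RibbonCategory C] {Y Y' : C}
    (P : PivotalPair Y Y') {S A : C} (g : A ⊗ Y ⟶ S) :
    P.corot g ▷ Y ≫ (α_ S Y' Y).hom ≫ S ◁ P.c ≫ (ρ_ S).hom = g := by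
  simp only [corot]
  calc
    _ = 𝟙 _ ⊗≫ A ◁ P.n ▷ Y ⊗≫ (g ▷ (Y' ⊗ Y) ≫ S ◁ P.c) ⊗≫ 𝟙 S := by monoidal
    _ = 𝟙 _ ⊗≫ A ◁ (P.n ▷ Y ⊗≫ Y ◁ P.c) ⊗≫ g ⊗≫ 𝟙 S := by
      rw [← whisker_exchange]; monoidal
    _ = _ := by rw [P.snake_n_c]; monoidal

/-- With B bent back, b and b* become r and q; moving q through the over-crossing of T brings r and
q together. -/
theorem overUnder_rotation {C : Type u} [Category.{v} C] [MonoidalCategory C]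
    [BraidedCategory C] [RightRigidCategory C] [RibbonCategory C] (T S A B : C)
    (r : S ⊗ Bᘁ ⟶ A) (q : A ⟶ S ⊗ Bᘁ) :
    T ◁ ((ρ_ S).inv ≫ S ◁ coevL B ≫ (α_ S Bᘁ B).inv ≫ r ▷ B) ≫ overUnder T A B ≫
        (q ▷ B ≫ (α_ S Bᘁ B).hom ≫ S ◁ ε_ B Bᘁ ≫ (ρ_ S).hom) ▷ T =
      (𝟙 (T ⊗ S) ⊗≫ T ◁ S ◁ coevL B ⊗≫ 𝟙 ((T ⊗ (S ⊗ Bᘁ)) ⊗ B)) ≫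
        (T ◁ (r ≫ q) ≫ (β_ T (S ⊗ Bᘁ)).hom) ▷ B ≫
          (𝟙 (((S ⊗ Bᘁ) ⊗ T) ⊗ B) ⊗≫ S ◁ Bᘁ ◁ (β_ B T).inv ⊗≫ S ◁ ε_ B Bᘁ ▷ T ⊗≫
            𝟙 (S ⊗ T)) := by
  simp only [overUnder]
  calc
    _ = 𝟙 (T ⊗ S) ⊗≫ T ◁ S ◁ coevL B ⊗≫ (T ◁ r ≫ (β_ T A).hom) ▷ B ⊗≫
          (A ◁ (β_ B T).inv ≫ q ▷ (B ⊗ T)) ⊗≫ S ◁ ε_ B Bᘁ ▷ T ⊗≫ 𝟙 (S ⊗ T) := by monoidal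
    _ = 𝟙 (T ⊗ S) ⊗≫ T ◁ S ◁ coevL B ⊗≫ (T ◁ r ≫ (β_ T A).hom ≫ q ▷ T) ▷ B ⊗≫
          S ◁ Bᘁ ◁ (β_ B T).inv ⊗≫ S ◁ ε_ B Bᘁ ▷ T ⊗≫ 𝟙 (S ⊗ T) := by
      rw [whisker_exchange]; monoidal
    _ = _ := by rw [← braiding_naturality_right]; monoidal

/-- The situation once r ≫ q has been summed to the identity: T passes over S, and B closes up into
a ring around T. -/
theorem overUnder_loop {C : Type u} [Category.{v} C] [MonoidalCategory C]
    [BraidedCategory C] [RightRigidCategory C] [RibbonCategory C] (T S B : C) :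
    (𝟙 (T ⊗ S) ⊗≫ T ◁ S ◁ coevL B ⊗≫ 𝟙 ((T ⊗ (S ⊗ Bᘁ)) ⊗ B)) ≫
        (T ◁ 𝟙 (S ⊗ Bᘁ) ≫ (β_ T (S ⊗ Bᘁ)).hom) ▷ B ≫
          (𝟙 (((S ⊗ Bᘁ) ⊗ T) ⊗ B) ⊗≫ S ◁ Bᘁ ◁ (β_ B T).inv ⊗≫ S ◁ ε_ B Bᘁ ▷ T ⊗≫
            𝟙 (S ⊗ T)) = (β_ T S).hom ≫ S ◁ ringUnder B T := by
  calc
    _ = 𝟙 (T ⊗ S) ⊗≫ ((T ⊗ S) ◁ coevL B ≫ (β_ T S).hom ▷ (Bᘁ ⊗ B)) ⊗≫ S ◁ (β_ T Bᘁ).hom ▷ B ⊗≫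
          S ◁ Bᘁ ◁ (β_ B T).inv ⊗≫ S ◁ ε_ B Bᘁ ▷ T ⊗≫ 𝟙 (S ⊗ T) := by
      rw [hexagon_right]; monoidal
    _ = _ := by
      rw [whisker_exchange, ringUnder_eq_loop]; monoidal

variable (k : Type w) [Field k] [IsAlgClosed k] {C : Type u} [Category.{v} C] [Abelian C]
  [Linear k C] [MonoidalCategory C] [MonoidalPreadditive C] [MonoidalLinear k C]
  [BraidedCategory C] [RightRigidCategory C] [RibbonCategory C]
  {ι : Type*} [Fintype ι] {s : ι → C} (hs : IsCompleteSetOfSimples s)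
include hs

theorem sum_overUnder [FusionCategory k C] (hd : ∀ i, qdim k (s i) ≠ 0) (T S B : C)
    {κ : ι → Type*} [∀ A, Fintype (κ A)]
    (b : ∀ A, Module.Basis (κ A) k (S ⟶ s A ⊗ B)) (b' : ∀ A, κ A → (s A ⊗ B ⟶ S))
    (h : ∀ A, IsDualFamily k (b A) (b' A)) :
    ∑ A, qdim k (s A) • ∑ j, T ◁ b A j ≫ overUnder T (s A) B ≫ b' A j ▷ T =
      (β_ T S).hom ≫ S ◁ ringUnder B T := by
  let P := PivotalPair.dual B
  have h1 (A : ι) (j : κ A) : T ◁ b A j ≫ overUnder T (s A) B ≫ b' A j ▷ T =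
      (𝟙 (T ⊗ S) ⊗≫ T ◁ S ◁ coevL B ⊗≫ 𝟙 ((T ⊗ (S ⊗ Bᘁ)) ⊗ B)) ≫
        (T ◁ ((b A).map (P.rot k S (s A)) j ≫ P.corot (b' A j)) ≫
          (β_ T (S ⊗ Bᘁ)).hom) ▷ B ≫
          (𝟙 (((S ⊗ Bᘁ) ⊗ T) ⊗ B) ⊗≫ S ◁ Bᘁ ◁ (β_ B T).inv ⊗≫ S ◁ ε_ B Bᘁ ▷ T ⊗≫
            𝟙 (S ⊗ T)) := by
    rw [← overUnder_rotation]
    congr 2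
    · exact ((P.rot k S (s A)).symm_apply_apply (b A j)).symm
    · exact congrArg (fun x => x ▷ T) (P.corot_inv (b' A j)).symm
  rw [← overUnder_loop, ← sum_comp_isDualFamily k hs hd _ _ fun A => P.isDualFamily_rot k (h A)]
  simp only [whiskerLeft_sum, sum_whiskerRight, Preadditive.comp_sum, Preadditive.sum_comp,
    MonoidalLinear.whiskerLeft_smul, MonoidalLinear.smul_whiskerRight, Linear.comp_smul,
    Linear.smul_comp, h1]

theorem sum_epsilonIsotypic [ModularTensorCategory k C] (S : C)
    {κ : ι → ι → Type*} [∀ A B, Fintype (κ A B)]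
    (b : ∀ A B, Module.Basis (κ A B) k (S ⟶ s A ⊗ s B)) (b' : ∀ A B, κ A B → (s A ⊗ s B ⟶ S))
    (h : ∀ A B, IsDualFamily k (b A B) (b' A B)) :
    ∑ A, ∑ B, epsilonIsotypic k s S (s A) (s B) (b A B) (b' A B) = 𝟙 _ := by
  have hd := qdim_ne_zero k hs
  have hD := globalDim_ne_zero k hs
  have h1 (t : ι) : ∑ B, ∑ A, (qdim k (s A) * qdim k (s B)) • ∑ j,
      annular k (s t) (s t ◁ b A B j ≫ overUnder (s t) (s A) (s B) ≫ b' A B j ▷ s t) =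
      ((∑ v, qdim k (s v) * sEntry k (s v) (s t)) / qdim k (s t)) •
        annular k (s t) (β_ (s t) S).hom := by
    -- The ring of B around t evaluates to S_{t,B^∨}, so the Kirby sum first appears in dual
    -- colours.
    rw [← sum_qdim_sEntry_dual k hs hd, Finset.sum_div, Finset.sum_smul]
    refine Finset.sum_congr rfl fun B _ => ?_
    have h2 := congrArg (annular k (s t)) (sum_overUnder k hs hd (s t) S (s B) (fun A => b A B)
      (fun A => b' A B) fun A => h A B)
    have := hs.simple t
    rw [eq_smul_of_qdim_ne_zero k (s t) (hd t) (ringUnder (s B) (s t)), qtr_ringUnder,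
      MonoidalLinear.whiskerLeft_smul, Linear.comp_smul, annular_smul, whiskerLeft_id,
      Category.comp_id, sEntry_comm] at h2
    rw [mul_div_assoc, mul_smul, ← h2]
    simp only [annular_sum, annular_smul, Finset.smul_sum, smul_smul]
    refine Finset.sum_congr rfl fun A _ => Finset.sum_congr rfl fun j _ => ?_
    rw [mul_comm]
  have h3 : ∑ A, ∑ B, epsilonIsotypic k s S (s A) (s B) (b A B) (b' A B) =
      (globalDim k s)⁻¹ • ∑ t, qdim k (s t) • ∑ B, ∑ A, (qdim k (s A) * qdim k (s B)) • ∑ j,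
        annular k (s t) (s t ◁ b A B j ≫ overUnder (s t) (s A) (s B) ≫ b' A B j ▷ s t) := by
    let F (A B t : ι) : (⟨S⟩ : TubeCategory k C) ⟶ ⟨S⟩ := (globalDim k s)⁻¹ • qdim k (s t) •
      (qdim k (s A) * qdim k (s B)) • ∑ j,
        annular k (s t) (s t ◁ b A B j ≫ overUnder (s t) (s A) (s B) ≫ b' A B j ▷ s t)
    calc
      _ = ∑ A, ∑ B, ∑ t, F A B t := by
        simp only [epsilonIsotypic, F, Finset.smul_sum, smul_smul]
        refine Finset.sum_congr rfl fun A _ => Finset.sum_congr rfl fun B _ =>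
          Finset.sum_congr rfl fun t _ => Finset.sum_congr rfl fun j _ => ?_
        congr 1
        ring
      _ = ∑ B, ∑ A, ∑ t, F A B t := Finset.sum_comm
      _ = ∑ B, ∑ t, ∑ A, F A B t := Finset.sum_congr rfl fun _ _ => Finset.sum_comm
      _ = ∑ t, ∑ B, ∑ A, F A B t := Finset.sum_comm
      _ = _ := by simp only [F, Finset.smul_sum]
  rw [h3]
  simp_rw [h1, smul_smul]
  obtain ⟨i₀, ⟨e₀⟩⟩ := hs.exists_iso (𝟙_ C) (FusionCategory.simple_unit (k := k))
  rw [Finset.sum_eq_single i₀]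
  · rw [sum_qdim_sEntry_of_iso k hs e₀, mul_div_cancel₀ _ (hd i₀), smul_smul,
      inv_mul_cancel₀ hD, one_smul]
    -- Sliding `e₀` around the cylinder replaces the strand `s i₀` by the unit.
    have h4 : (β_ (s i₀) S).hom = ((β_ (s i₀) S).hom ≫ S ◁ e₀.inv) ≫ S ◁ e₀.hom := by simp
    rw [h4, ← annular_slide, braiding_naturality_left_assoc, ← emb_id, emb]
    simp
  · intro t _ ht
    have := hs.simple t
    rw [sum_qdim_sEntry_eq_zero k hs]
    · simp
    · exact ⟨fun e => ht (hs.eq_of_iso _ _ ⟨e.symm ≪≫ e₀⟩)⟩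
  · simp

end Completeness

/-! ### Morphisms between the objects ⟨A,B⟩ -/

section SimpleObjects

open ExactPairing BraidedCategory

variable (k : Type w) [Field k] [IsAlgClosed k] {C : Type u} [Category.{v} C] [Abelian C]
  [Linear k C] [MonoidalCategory C] [MonoidalPreadditive C] [MonoidalLinear k C]
  [BraidedCategory C] [RightRigidCategory C] [RibbonCategory C]

/-- The half braiding of `X ⊗ Y` passing over `X` and under `Y`. -/
abbrev HB.overUnder (X Y : C) : HB (X ⊗ Y) := (HB.over X).prod (HB.under Y)

variable {ι : Type*} [Fintype ι] {s : ι → C} (hs : IsCompleteSetOfSimples s)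

theorem epsilonTensor_eq [FusionCategory k C] (s : ι → C) (X Y : C) :
    epsilonTensor k s X Y = (globalDim k s)⁻¹ • (HB.overUnder X Y).loop k s := by
  simp only [epsilonTensor, HB.loop, overUnder_eq]

include hs

/-- A morphism between tensor products factors through intermediate simple objects. -/
theorem exists_channels [FusionCategory k C] {A B A' B' : C} (f : A ⊗ B ⟶ A' ⊗ B') :
    ∃ (n : ℕ) (t : Fin n → ι) (a : ∀ r, A ⟶ A' ⊗ s (t r)) (b : ∀ r, s (t r) ⊗ B ⟶ B'),
      f = ∑ r, a r ▷ B ≫ (α_ A' (s (t r)) B).hom ≫ A' ◁ b r := by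
  obtain ⟨n, t, p, i, h⟩ := IsCompleteSetOfSimples.exists_resolution k hs (A'ᘁ ⊗ A)
  refine ⟨n, t, fun r => (λ_ A).inv ≫ η_ A' A'ᘁ ▷ A ≫ (α_ A' A'ᘁ A).hom ≫ A' ◁ p r,
    fun r => i r ▷ B ≫ (α_ A'ᘁ A B).hom ≫ A'ᘁ ◁ f ≫ (α_ A'ᘁ A' B').inv ≫ ε_ A' A'ᘁ ▷ B' ≫
      (λ_ B').hom, ?_⟩
  -- The snake identity for `A'`, which exposes an identity of `A'ᘁ ⊗ A` where the resolution is
  -- inserted.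
  have h1 : f = ((λ_ A).inv ≫ η_ A' A'ᘁ ▷ A ≫ (α_ A' A'ᘁ A).hom) ▷ B ≫
      (A' ◁ 𝟙 (A'ᘁ ⊗ A)) ▷ B ≫ (α_ A' (A'ᘁ ⊗ A) B).hom ≫ A' ◁ ((α_ A'ᘁ A B).hom ≫ A'ᘁ ◁ f ≫
        (α_ A'ᘁ A' B').inv ≫ ε_ A' A'ᘁ ▷ B' ≫ (λ_ B').hom) := by
    symm
    calc
      _ = 𝟙 _ ⊗≫ (η_ A' A'ᘁ ▷ (A ⊗ B) ≫ (A' ⊗ A'ᘁ) ◁ f) ⊗≫ A' ◁ ε_ A' A'ᘁ ▷ B' ⊗≫ 𝟙 _ := by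
        monoidal
      _ = f ⊗≫ (η_ A' A'ᘁ ▷ A' ⊗≫ A' ◁ ε_ A' A'ᘁ) ▷ B' ⊗≫ 𝟙 _ := by
        rw [← whisker_exchange]; monoidal
      _ = f := by rw [evaluation_coevaluation'']; monoidal
  conv_lhs => rw [h1, ← h]
  simp only [whiskerLeft_sum, sum_whiskerRight, Preadditive.comp_sum, Preadditive.sum_comp]
  refine Finset.sum_congr rfl fun r _ => ?_
  monoidal

section Modular

variable [ModularTensorCategory k C]

/-- With `unwind_emb_comp_epsilonTensor` this identifies maps Z → ⟨X,Y⟩ with Hom_C(Z, X ⊗ Y). -/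
theorem comp_epsilonTensor {X Y Z : C} (x : (⟨Z⟩ : TubeCategory k C) ⟶ ⟨X ⊗ Y⟩) :
    x ≫ epsilonTensor k s X Y =
      emb k ((HB.overUnder X Y).unwind k Z x) ≫ epsilonTensor k s X Y := by
  rw [epsilonTensor_eq, Linear.comp_smul, Linear.comp_smul,
    HB.comp_loop k hs (qdim_ne_zero k hs)]

theorem unwind_emb_comp_epsilonTensor {X Y Z : C} (m : Z ⟶ X ⊗ Y) :
    (HB.overUnder X Y).unwind k Z (emb k m ≫ epsilonTensor k s X Y) = m := by
  rw [epsilonTensor_eq, Linear.comp_smul, map_smul, HB.unwind_emb_comp_loop, smul_smul,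
    inv_mul_cancel₀ (globalDim_ne_zero k hs), one_smul]

theorem epsilonTensor_idem (X Y : C) :
    epsilonTensor k s X Y ≫ epsilonTensor k s X Y = epsilonTensor k s X Y := by
  have h := unwind_emb_comp_epsilonTensor k hs (𝟙 (X ⊗ Y))
  rw [emb_id, Category.id_comp] at h
  rw [comp_epsilonTensor k hs, h, emb_id, Category.id_comp]

theorem emb_comp_epsilonTensor_injective {X Y Z : C} {m m' : Z ⟶ X ⊗ Y}
    (h : emb k m ≫ epsilonTensor k s X Y = emb k m' ≫ epsilonTensor k s X Y) : m = m' := by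
  rw [← unwind_emb_comp_epsilonTensor k hs m, h, unwind_emb_comp_epsilonTensor k hs]

theorem ringOver_eq_smul (T : C) (j : ι) :
    ringOver T (s j) = (sEntry k T (s j) / qdim k (s j)) • 𝟙 (s j) := by
  have := hs.simple j
  rw [← qtr_ringOver]
  exact eq_smul_of_qdim_ne_zero k _ (qdim_ne_zero k hs j) _

theorem ringUnder_eq_smul (T : C) (j : ι) :
    ringUnder T (s j) = (sEntry k (s j) Tᘁ / qdim k (s j)) • 𝟙 (s j) := by
  have := hs.simple j
  rw [← qtr_ringUnder]
  exact eq_smul_of_qdim_ne_zero k _ (qdim_ne_zero k hs j) _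

/-- The target loop absorbs the source loop, which becomes a Kirby-coloured ring around the
exchanged strand. -/
theorem loop_comp_emb_channel {A B A' B' : C} {j : ι} (a : A ⟶ A' ⊗ s j) (b : s j ⊗ B ⟶ B') :
    (HB.overUnder A B).loop k s ≫ emb k (a ▷ B ≫ (α_ A' (s j) B).hom ≫ A' ◁ b) ≫
        (HB.overUnder A' B').loop k s =
      ((∑ t, qdim k (s t) * sEntry k (s t) (s j)) / qdim k (s j)) •
        emb k (a ▷ B ≫ (α_ A' (s j) B).hom ≫ A' ◁ b) ≫ (HB.overUnder A' B').loop k s := by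
  conv_lhs => rw [HB.loop, ← Category.assoc]
  simp only [Preadditive.sum_comp, Linear.smul_comp, annular_comp_emb]
  rw [Finset.sum_div, Finset.sum_smul]
  refine Finset.sum_congr rfl fun t _ => ?_
  rw [HB.comp_loop k hs (qdim_ne_zero k hs), HB.unwind_annular, closure_overUnder_channel,
    ringOver_eq_smul k hs]
  simp only [MonoidalLinear.smul_whiskerRight, MonoidalLinear.whiskerLeft_smul, id_whiskerRight,
    whiskerLeft_id, Linear.smul_comp, Category.id_comp, Linear.comp_smul, emb_smul, smul_smul,
    mul_div_assoc]

/-- Only the channels through the unit survive, and these are tensor products a ⊗ b. Taking V = ⊥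
gives orthogonality; taking V spanned by ε_A^B gives scalar endomorphisms. -/
theorem epsilonTensor_comp_mem {A B A' B' : C} [Simple A] [Simple B]
    (V : Submodule k ((⟨A ⊗ B⟩ : TubeCategory k C) ⟶ ⟨A' ⊗ B'⟩))
    (hV : ∀ (a : A ⟶ A') (b : B ⟶ B'), emb k (a ⊗ₘ b) ≫ epsilonTensor k s A' B' ∈ V)
    (x : (⟨A ⊗ B⟩ : TubeCategory k C) ⟶ ⟨A' ⊗ B'⟩) :
    epsilonTensor k s A B ≫ x ≫ epsilonTensor k s A' B' ∈ V := by
  obtain ⟨n, t, a, b, h⟩ :=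
    exists_channels k hs ((HB.overUnder A' B').unwind k (A ⊗ B) x)
  rw [comp_epsilonTensor k hs, h, emb_sum, Preadditive.sum_comp, Preadditive.comp_sum]
  refine Submodule.sum_mem _ fun r _ => ?_
  have := hs.simple (t r)
  have h1 := loop_comp_emb_channel k hs (a r) (b r)
  by_cases hr : Nonempty (𝟙_ C ≅ s (t r))
  · obtain ⟨e⟩ := hr
    have h2 : a r ▷ B ≫ (α_ A' (s (t r)) B).hom ≫ A' ◁ b r =
        (a r ≫ A' ◁ e.inv ≫ (ρ_ A').hom) ⊗ₘ ((λ_ B).inv ≫ e.hom ▷ B ≫ b r) := by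
      rw [MonoidalCategory.tensorHom_def]
      calc
        _ = a r ▷ B ⊗≫ A' ◁ (e.inv ≫ e.hom) ▷ B ⊗≫ A' ◁ b r := by
          rw [e.inv_hom_id]; monoidal
        _ = _ := by monoidal
    have h3 := V.smul_mem ((globalDim k s)⁻¹ *
      ((∑ v, qdim k (s v) * sEntry k (s v) (s (t r))) / qdim k (s (t r))))
      (hV (a r ≫ A' ◁ e.inv ≫ (ρ_ A').hom) ((λ_ B).inv ≫ e.hom ▷ B ≫ b r))
    convert! h3 using 1
    rw [← h2]
    simp only [epsilonTensor_eq, Linear.smul_comp, Linear.comp_smul]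
    rw [h1]
    simp only [smul_smul]
    congr 1
    ring
  · rw [sum_qdim_sEntry_eq_zero k hs (not_nonempty_iff.mp hr), zero_div, zero_smul] at h1
    simp only [epsilonTensor_eq, Linear.smul_comp, Linear.comp_smul]
    rw [h1, smul_zero, smul_zero]
    exact V.zero_mem

theorem epsilonTensor_comp_eq_zero {A B A' B' : ι} (h : ¬ (A = A' ∧ B = B'))
    (x : (⟨s A ⊗ s B⟩ : TubeCategory k C) ⟶ ⟨s A' ⊗ s B'⟩) :
    epsilonTensor k s (s A) (s B) ≫ x ≫ epsilonTensor k s (s A') (s B') = 0 := by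
  have := hs.simple
  rw [← Submodule.mem_bot k]
  refine epsilonTensor_comp_mem k hs ⊥ (fun a b => ?_) x
  have h1 : a ⊗ₘ b = 0 := by
    by_cases hA : A = A'
    · rw [hs.hom_eq_zero (fun hB => h ⟨hA, hB⟩) b, MonoidalPreadditive.tensor_zero]
    · rw [hs.hom_eq_zero hA a, MonoidalPreadditive.zero_tensor]
  rw [h1, Submodule.mem_bot, emb]
  simp [annular_zero]

theorem epsilonTensor_comp_eq_smul (A B : ι)
    (x : (⟨s A ⊗ s B⟩ : TubeCategory k C) ⟶ ⟨s A ⊗ s B⟩) :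
    ∃ c : k, epsilonTensor k s (s A) (s B) ≫ x ≫ epsilonTensor k s (s A) (s B) =
      c • epsilonTensor k s (s A) (s B) := by
  have := hs.simple
  have h := epsilonTensor_comp_mem k hs (Submodule.span k {epsilonTensor k s (s A) (s B)})
    (fun a b => ?_) x
  · obtain ⟨c, hc⟩ := Submodule.mem_span_singleton.mp h
    exact ⟨c, hc.symm⟩
  · obtain ⟨c, rfl⟩ := eq_smul_id_of_simple k _ a
    obtain ⟨c', rfl⟩ := eq_smul_id_of_simple k _ b
    rw [Submodule.mem_span_singleton]
    refine ⟨c * c', ?_⟩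
    rw [MonoidalCategory.tensorHom_def]
    simp [emb_smul, emb_id, mul_smul, smul_comm c c']

/-- Otherwise injectivity makes the identity of A ⊗ B zero, although its trace is d(A) d(B). -/
theorem epsilonTensor_ne_zero (A B : ι) : epsilonTensor k s (s A) (s B) ≠ 0 := by
  intro h0
  have h := emb_comp_epsilonTensor_injective k hs (m := 𝟙 (s A ⊗ s B)) (m' := 0)
    (by rw [h0, Limits.comp_zero, Limits.comp_zero])
  refine mul_ne_zero (qdim_ne_zero k hs A) (qdim_ne_zero k hs B) ?_
  rw [← qdim_tensor, qdim, h, ← zero_smul k (𝟙 (s A ⊗ s B)), qtr_smul, zero_mul]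

theorem annular_over_comp_emb {A S : C} {j : ι} (U : C) (m : S ⟶ A ⊗ s j) :
    annular k U (β_ U S).hom ≫ emb k m ≫ epsilonTensor k s A (s j) =
      (sEntry k U (s j) / qdim k (s j)) • emb k m ≫ epsilonTensor k s A (s j) := by
  rw [← Category.assoc, annular_comp_emb, ← braiding_naturality_right, ← emb_comp_annular,
    Category.assoc, comp_epsilonTensor k hs (annular k U _), HB.unwind_annular,
    closure_overUnder_over, ringOver_eq_smul k hs]
  simp [emb_smul, emb_id]

theorem annular_under_comp_emb {B S : C} {j : ι} (U : C) (m : S ⟶ s j ⊗ B) :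
    annular k U (β_ S U).inv ≫ emb k m ≫ epsilonTensor k s (s j) B =
      (sEntry k (s j) Uᘁ / qdim k (s j)) • emb k m ≫ epsilonTensor k s (s j) B := by
  rw [← Category.assoc, annular_comp_emb, ← braiding_inv_naturality_right, ← emb_comp_annular,
    Category.assoc, comp_epsilonTensor k hs (annular k U _), HB.unwind_annular,
    closure_overUnder_under, ringUnder_eq_smul k hs]
  simp [emb_smul, emb_id]

end Modular

end SimpleObjects

/-! ### Eigenvalues of γ and isotypic components -/

section Isotypic

variable (k : Type w) [Field k] [IsAlgClosed k] {C : Type u} [Category.{v} C] [Abelian C]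
  [Linear k C] [MonoidalCategory C] [MonoidalPreadditive C] [MonoidalLinear k C]
  [BraidedCategory C] [RightRigidCategory C] [RibbonCategory C]

theorem epsilonIsotypic_eq [FusionCategory k C] {ι : Type*} [Fintype ι] (s : ι → C) {S A B : C}
    {κ : Type*} [Fintype κ] (b : κ → (S ⟶ A ⊗ B)) (b' : κ → (A ⊗ B ⟶ S)) :
    epsilonIsotypic k s S A B b b' =
      (qdim k A * qdim k B) • ∑ j, emb k (b j) ≫ epsilonTensor k s A B ≫ emb k (b' j) := by
  have h : ∀ j, emb k (b j) ≫ epsilonTensor k s A B ≫ emb k (b' j) =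
      (globalDim k s)⁻¹ • ∑ t, qdim k (s t) •
        annular k (s t) (s t ◁ b j ≫ overUnder (s t) A B ≫ b' j ▷ s t) := fun j => by
    simp only [epsilonTensor, Linear.smul_comp, Linear.comp_smul, Preadditive.sum_comp,
      Preadditive.comp_sum, annular_comp_emb, emb_comp_annular]
  simp only [h]
  rw [← Finset.smul_sum, smul_smul, Finset.sum_comm, epsilonIsotypic, div_eq_mul_inv]

variable [ModularTensorCategory k C] {ι : Type*} [Fintype ι] {s : ι → C}
  (hs : IsCompleteSetOfSimples s)

/-- Y and Y^∨∨ are both duals of Y^∨. This is needed because the under-strand I^∨ of γ yields a Hopf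
link with I^∨∨. -/
theorem sEntry_double_dual (X Y : C) : sEntry k X Yᘁᘁ = sEntry k Y X := by
  rw [sEntry_comm, sEntry_iso_left k
    (rightDualIso (inferInstance : ExactPairing Yᘁ Yᘁᘁ) (pivotalExactPairing Y))]

theorem gamma_eq_comp (I J S : C) :
    gamma k I J S = annular k Iᘁ (β_ S Iᘁ).inv ≫ annular k Jᘁ (β_ Jᘁ S).hom :=
  (annular_comp k _ _ _ _).symm

include hs

theorem gamma_comp_emb (I J S : C) (A B : ι) (m : S ⟶ s A ⊗ s B) :
    gamma k I J S ≫ emb k m ≫ epsilonTensor k s (s A) (s B) =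
      (sEntry k I (s A) * sEntry k (s B) Jᘁ / (qdim k (s A) * qdim k (s B))) •
        emb k m ≫ epsilonTensor k s (s A) (s B) := by
  rw [gamma_eq_comp, Category.assoc, annular_over_comp_emb k hs, Linear.comp_smul,
    annular_under_comp_emb k hs, smul_smul, sEntry_double_dual, sEntry_comm k Jᘁ]
  congr 1
  rw [div_mul_div_comm, mul_comm (sEntry k (s B) _), mul_comm (qdim k (s B))]

variable {S : C} {κ : ι → ι → Type*} [∀ A B, Fintype (κ A B)]
  {b : ∀ A B, κ A B → (S ⟶ s A ⊗ s B)} {b' : ∀ A B, κ A B → (s A ⊗ s B ⟶ S)}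

theorem gamma_eq_sum (h1 : ∑ A, ∑ B, epsilonIsotypic k s S (s A) (s B) (b A B) (b' A B) = 𝟙 _)
    (I J : C) :
    gamma k I J S = ∑ A, ∑ B, (sEntry k I (s A) * sEntry k (s B) Jᘁ /
      (qdim k (s A) * qdim k (s B))) •
        epsilonIsotypic k s S (s A) (s B) (b A B) (b' A B) := by
  rw [← Category.comp_id (gamma k I J S), ← h1, Preadditive.comp_sum]
  refine Finset.sum_congr rfl fun A _ => ?_
  rw [Preadditive.comp_sum]
  refine Finset.sum_congr rfl fun B _ => ?_
  rw [epsilonIsotypic_eq, Linear.comp_smul, Preadditive.comp_sum, smul_comm]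
  simp only [Finset.smul_sum]
  refine Finset.sum_congr rfl fun j _ => ?_
  have h := gamma_comp_emb k hs I J S A B (b A B j) =≫ emb k (b' A B j)
  simp only [Category.assoc, Linear.smul_comp] at h
  rw [h]

/-- Insert the completeness relation before x; by orthogonality all other summands vanish on maps
into ⟨A,B⟩. -/
theorem epsilonIsotypic_comp
    (h1 : ∑ A, ∑ B, epsilonIsotypic k s S (s A) (s B) (b A B) (b' A B) = 𝟙 _) (A B : ι)
    (x : (⟨S⟩ : TubeCategory k C) ⟶ ⟨s A ⊗ s B⟩) :
    epsilonIsotypic k s S (s A) (s B) (b A B) (b' A B) ≫ x ≫ epsilonTensor k s (s A) (s B) =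
      x ≫ epsilonTensor k s (s A) (s B) := by
  have h0 : ∀ A' B', ¬ (A' = A ∧ B' = B) →
      epsilonIsotypic k s S (s A') (s B') (b A' B') (b' A' B') ≫ x ≫
        epsilonTensor k s (s A) (s B) = 0 := fun A' B' h => by
    rw [epsilonIsotypic_eq, Linear.smul_comp, Preadditive.sum_comp]
    refine smul_eq_zero_of_right _ (Finset.sum_eq_zero fun j _ => ?_)
    have h2 := epsilonTensor_comp_eq_zero k hs h (emb k (b' A' B' j) ≫ x)
    simp only [Category.assoc] at h2 ⊢
    rw [h2, Limits.comp_zero]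
  conv_rhs => rw [← Category.id_comp x, ← h1]
  simp only [Preadditive.sum_comp, Category.assoc]
  rw [Finset.sum_eq_single A, Finset.sum_eq_single B]
  · exact fun B' _ hB => h0 A B' fun h => hB h.2
  · simp
  · exact fun A' _ hA => Finset.sum_eq_zero fun B' _ => h0 A' B' fun h => hA h.1
  · simp

theorem comp_epsilonIsotypic
    (h1 : ∑ A, ∑ B, epsilonIsotypic k s S (s A) (s B) (b A B) (b' A B) = 𝟙 _) (A B : ι)
    (x : (⟨s A ⊗ s B⟩ : TubeCategory k C) ⟶ ⟨S⟩) :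
    epsilonTensor k s (s A) (s B) ≫ x ≫ epsilonIsotypic k s S (s A) (s B) (b A B) (b' A B) =
      epsilonTensor k s (s A) (s B) ≫ x := by
  have h0 : ∀ A' B', ¬ (A' = A ∧ B' = B) →
      epsilonTensor k s (s A) (s B) ≫ x ≫
        epsilonIsotypic k s S (s A') (s B') (b A' B') (b' A' B') = 0 := fun A' B' h => by
    simp only [epsilonIsotypic_eq, Linear.comp_smul, Preadditive.comp_sum]
    refine smul_eq_zero_of_right _ (Finset.sum_eq_zero fun j _ => ?_)
    have h2 := epsilonTensor_comp_eq_zero k hs (fun h3 => h ⟨h3.1.symm, h3.2.symm⟩)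
      (x ≫ emb k (b A' B' j)) =≫ emb k (b' A' B' j)
    simpa only [Category.assoc, Limits.zero_comp] using h2
  conv_rhs => rw [← Category.comp_id x, ← h1]
  simp only [Preadditive.comp_sum]
  rw [Finset.sum_eq_single A, Finset.sum_eq_single B]
  · exact fun B' _ hB => h0 A B' fun h => hB h.2
  · simp
  · exact fun A' _ hA => Finset.sum_eq_zero fun B' _ => h0 A' B' fun h => hA h.1
  · simp

theorem epsilonIsotypic_idem
    (h1 : ∑ A, ∑ B, epsilonIsotypic k s S (s A) (s B) (b A B) (b' A B) = 𝟙 _) (A B : ι) :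
    epsilonIsotypic k s S (s A) (s B) (b A B) (b' A B) ≫
      epsilonIsotypic k s S (s A) (s B) (b A B) (b' A B) =
        epsilonIsotypic k s S (s A) (s B) (b A B) (b' A B) := by
  have h : epsilonIsotypic k s S (s A) (s B) (b A B) (b' A B) = _ :=
    epsilonIsotypic_eq k s (b A B) (b' A B)
  nth_rewrite 1 [h]
  nth_rewrite 2 [h]
  simp only [Linear.smul_comp, Preadditive.sum_comp, Category.assoc,
    comp_epsilonIsotypic k hs h1]

/-- By Schur the left side is a scalar c_i times ε_A^B. Since ε(S,A,B) fixes b_j followed by ε_A^B,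
one gets Σ c_i b_i = b_j, and linear independence determines the c_i. -/
theorem epsilonTensor_comp_emb_dual
    (h1 : ∑ A, ∑ B, epsilonIsotypic k s S (s A) (s B) (b A B) (b' A B) = 𝟙 _) (A B : ι)
    (hb : LinearIndependent k (b A B)) (i j : κ A B) [Decidable (i = j)] :
    (qdim k (s A) * qdim k (s B)) • epsilonTensor k s (s A) (s B) ≫ emb k (b' A B i) ≫
        emb k (b A B j) ≫ epsilonTensor k s (s A) (s B) =
      (if i = j then (1 : k) else 0) • epsilonTensor k s (s A) (s B) := by
  classical
  have h2 : ∀ i, ∃ c : k, (qdim k (s A) * qdim k (s B)) • epsilonTensor k s (s A) (s B) ≫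
      emb k (b' A B i) ≫ emb k (b A B j) ≫ epsilonTensor k s (s A) (s B) =
        c • epsilonTensor k s (s A) (s B) := fun i => by
    obtain ⟨c, hc⟩ := epsilonTensor_comp_eq_smul k hs A B (emb k (b' A B i) ≫ emb k (b A B j))
    rw [Category.assoc] at hc
    exact ⟨_, by rw [hc, smul_smul]⟩
  choose c hc using h2
  have h3 := epsilonIsotypic_comp k hs h1 A B (emb k (b A B j))
  rw [epsilonIsotypic_eq, Linear.smul_comp, Preadditive.sum_comp, Finset.smul_sum] at h3
  have h4 : emb k (∑ i, c i • b A B i) ≫ epsilonTensor k s (s A) (s B) =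
      emb k (b A B j) ≫ epsilonTensor k s (s A) (s B) := by
    rw [← h3, emb_sum, Preadditive.sum_comp]
    refine Finset.sum_congr rfl fun i _ => ?_
    simp only [Category.assoc]
    rw [← Linear.comp_smul, hc, emb_smul, Linear.smul_comp, Linear.comp_smul]
  have h5 := emb_comp_epsilonTensor_injective k hs h4
  have h6 : ∑ i, (c i - if i = j then 1 else 0) • b A B i = 0 := by
    simp [sub_smul, h5]
  have h7 := Fintype.linearIndependent_iff.mp hb _ h6 i
  rw [hc, sub_eq_zero.mp h7]
  congr

/-- By completeness, a nonzero map into ⟨A,B⟩ stays nonzero after some map out of ⟨A,B⟩; the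
resulting endomorphism is a nonzero scalar and can be inverted. -/
theorem epsilonTensor_factor (A B : ι) {Z : C} (x : (⟨Z⟩ : TubeCategory k C) ⟶ ⟨s A ⊗ s B⟩)
    (hx : x ≫ epsilonTensor k s (s A) (s B) ≠ 0) :
    ∃ g : (⟨s A ⊗ s B⟩ : TubeCategory k C) ⟶ ⟨Z⟩,
      epsilonTensor k s (s A) (s B) ≫ g ≫ x ≫ epsilonTensor k s (s A) (s B) =
        epsilonTensor k s (s A) (s B) := by
  -- Unwinding reduces this to C, where simple sources detect zero.
  have h0 : ∃ (t : ι) (q : s t ⟶ Z),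
      emb k q ≫ x ≫ epsilonTensor k s (s A) (s B) ≠ 0 := by
    by_contra! h
    refine hx ?_
    rw [comp_epsilonTensor k hs] at h ⊢
    have h2 : (HB.overUnder (s A) (s B)).unwind k Z x = 0 :=
      IsCompleteSetOfSimples.hom_ext_left k hs fun t p => by
        refine emb_comp_epsilonTensor_injective k hs ?_
        rw [emb_comp, Category.assoc, h, Limits.comp_zero, emb]
        simp [annular_zero]
    rw [h2, emb]
    simp [annular_zero]
  obtain ⟨t, q, hq⟩ := h0
  have hf : ∀ A B, ∃ b', IsDualFamily k (Module.finBasis k (s t ⟶ s A ⊗ s B)) b' := fun A B =>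
    exists_isDualFamily k hs (qdim_ne_zero k hs) _
  choose b' hb' using hf
  have h1 := sum_epsilonIsotypic k hs (s t) (fun A B => Module.finBasis k (s t ⟶ s A ⊗ s B)) b' hb'
  have h2 := epsilonIsotypic_comp k hs h1 A B (emb k q ≫ x)
  rw [epsilonIsotypic_eq, Linear.smul_comp, Preadditive.sum_comp, Category.assoc] at h2
  obtain ⟨j, hj⟩ : ∃ j, epsilonTensor k s (s A) (s B) ≫ emb k (b' A B j) ≫ emb k q ≫ x ≫
      epsilonTensor k s (s A) (s B) ≠ 0 := by
    by_contra! h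
    refine hq ?_
    rw [← h2]
    refine smul_eq_zero_of_right _ (Finset.sum_eq_zero fun j _ => ?_)
    simp only [Category.assoc]
    rw [h j, Limits.comp_zero]
  obtain ⟨c, hc⟩ := epsilonTensor_comp_eq_smul k hs A B (emb k (b' A B j) ≫ emb k q ≫ x)
  simp only [Category.assoc] at hc
  have hc0 : c ≠ 0 := fun h => hj (by rw [hc, h, zero_smul])
  refine ⟨c⁻¹ • emb k (b' A B j) ≫ emb k q, ?_⟩
  rw [Linear.smul_comp, Linear.comp_smul, Category.assoc, hc, smul_smul, inv_mul_cancel₀ hc0,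
    one_smul]

theorem simple_karoubi (A B : ι)
    (h : epsilonTensor k s (s A) (s B) ≫ epsilonTensor k s (s A) (s B) =
      epsilonTensor k s (s A) (s B)) :
    Simple (⟨_, epsilonTensor k s (s A) (s B), h⟩ : Idempotents.Karoubi (TubeCategory k C)) where
  mono_isIso_iff_nonzero {Y} f _ := by
    constructor
    · intro hf h0
      have h2 : 𝟙 (⟨_, epsilonTensor k s (s A) (s B), h⟩ :
          Idempotents.Karoubi (TubeCategory k C)) = 0 := by
        rw [← IsIso.inv_hom_id f]
        nth_rewrite 2 [h0]
        exact Limits.comp_zero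
      exact epsilonTensor_ne_zero k hs A B (congrArg Idempotents.Karoubi.Hom.f h2)
    · intro hf
      have hx : f.f ≫ epsilonTensor k s (s A) (s B) = f.f := Idempotents.Karoubi.comp_p f
      obtain ⟨g, hg⟩ := epsilonTensor_factor k hs A B f.f (by
        rw [hx]
        exact fun h0 => hf ((Idempotents.Karoubi.hom_eq_zero_iff).mpr h0))
      rw [hx] at hg
      let g' : (⟨_, epsilonTensor k s (s A) (s B), h⟩ :
          Idempotents.Karoubi (TubeCategory k C)) ⟶ Y :=
        -- A section of the nonzero monomorphism `f`, which is therefore an isomorphism.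
        ⟨epsilonTensor k s (s A) (s B) ≫ g ≫ Y.p, by simp [reassoc_of% h, Y.idem]⟩
      have hg' : g' ≫ f = 𝟙 _ := by
        ext
        simpa [g', Idempotents.Karoubi.p_comp f] using hg
      have := IsSplitEpi.mk' (⟨g', hg'⟩ : SplitEpi f)
      exact isIso_of_mono_of_isSplitEpi f

theorem isIsotypicProjection_epsilonIsotypic
    (h1 : ∑ A, ∑ B, epsilonIsotypic k s S (s A) (s B) (b A B) (b' A B) = 𝟙 _) (A B : ι)
    (hb : LinearIndependent k (b A B))
    (h : epsilonTensor k s (s A) (s B) ≫ epsilonTensor k s (s A) (s B) =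
      epsilonTensor k s (s A) (s B)) :
    IsIsotypicProjection
      (⟨_, epsilonTensor k s (s A) (s B), h⟩ : Idempotents.Karoubi (TubeCategory k C))
      ((Idempotents.toKaroubi _).obj ⟨S⟩)
      ((Idempotents.toKaroubi _).map
        (epsilonIsotypic k s S (s A) (s B) (b A B) (b' A B))) where
  simple := simple_karoubi k hs A B h
  idem := by rw [← Functor.map_comp, epsilonIsotypic_idem k hs h1]
  sum_of_copies := by
    classical
    let e := (Fintype.equivFin (κ A B)).symm
    -- The factor d(A) d(B) of ε(S,A,B) is placed entirely on the inclusions.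
    refine ⟨_, fun a => ⟨(qdim k (s A) * qdim k (s B)) •
        epsilonTensor k s (s A) (s B) ≫ emb k (b' A B (e a)), ?_⟩,
      fun a => ⟨emb k (b A B (e a)) ≫ epsilonTensor k s (s A) (s B), ?_⟩, fun a => ?_,
      fun a c hac => ?_, ?_⟩
    · simp [reassoc_of% h]
    · simp [h]
    · ext
      have h2 := epsilonTensor_comp_emb_dual k hs h1 A B hb (e a) (e a)
      rw [if_pos rfl, one_smul] at h2
      simpa using h2
    · ext
      have h2 := epsilonTensor_comp_emb_dual k hs h1 A B hb (e a) (e c)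
      rw [if_neg (fun h => hac (e.injective h)), zero_smul] at h2
      simpa using h2
    · ext
      rw [Idempotents.Karoubi.sum_hom]
      simp only [Idempotents.Karoubi.comp_f, Idempotents.toKaroubi_map_f, Linear.comp_smul,
        Category.assoc, reassoc_of% h]
      rw [← Finset.smul_sum, epsilonIsotypic_eq]
      congr 1
      exact Equiv.sum_comp e fun j =>
        emb k (b A B j) ≫ epsilonTensor k s (s A) (s B) ≫ emb k (b' A B j)
  comp_eq f := by
    ext
    have h2 := comp_epsilonIsotypic k hs h1 A B f.f
    have h3 : epsilonTensor k s (s A) (s B) ≫ f.f = f.f := Idempotents.Karoubi.p_comp f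
    rw [← Category.assoc, h3] at h2
    exact h2
  eq_comp f := by
    ext
    have h2 := epsilonIsotypic_comp k hs h1 A B f.f
    have h3 : f.f ≫ epsilonTensor k s (s A) (s B) = f.f := Idempotents.Karoubi.comp_p f
    rw [h3] at h2
    exact h2

end Isotypic

end TubeS

end

theorem mainTheorem5 {k : Type*} [Field k] [IsAlgClosed k] {C : Type*} [Category* C]
    [Abelian C] [Linear k C] [MonoidalCategory C] [MonoidalPreadditive C] [MonoidalLinear k C]
    [BraidedCategory C] [RightRigidCategory C] [TubeS.RibbonCategory C]
    [TubeS.ModularTensorCategory k C]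
    {ι : Type*} [Fintype ι] (s : ι → C) (hs : TubeS.IsCompleteSetOfSimples s) (S : ι) :
    (∀ A B : ι, (TubeS.tracePairing k (s S) (s A ⊗ s B)).IsPerfPair) ∧
    ∀ (κ : ι → ι → Type*) [∀ A B, Fintype (κ A B)]
      (b : ∀ A B, Module.Basis (κ A B) k (s S ⟶ s A ⊗ s B))
      (b' : ∀ A B, κ A B → (s A ⊗ s B ⟶ s S)),
      (∀ A B, TubeS.IsDualFamily k (b A B) (b' A B)) →
      (∀ I J : ι, TubeS.gamma k (s I) (s J) (s S) =
        ∑ A, ∑ B, (TubeS.sEntry k (s I) (s A) * TubeS.sEntry k (s B) (s J)ᘁ /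
          (TubeS.qdim k (s A) * TubeS.qdim k (s B))) •
            TubeS.epsilonIsotypic k s (s S) (s A) (s B) (b A B) (b' A B)) ∧
      ∀ A B : ι,
        ∃ hAB : TubeS.epsilonTensor k s (s A) (s B) ≫ TubeS.epsilonTensor k s (s A) (s B) =
            TubeS.epsilonTensor k s (s A) (s B),
          TubeS.IsIsotypicProjection
            (⟨_, TubeS.epsilonTensor k s (s A) (s B), hAB⟩ :
              Idempotents.Karoubi (TubeS.TubeCategory k C))
            ((Idempotents.toKaroubi _).obj ⟨s S⟩)
            ((Idempotents.toKaroubi _).map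
              (TubeS.epsilonIsotypic k s (s S) (s A) (s B) (b A B) (b' A B))) := by
  refine ⟨fun A B => TubeS.isPerfPair_tracePairing k hs (TubeS.qdim_ne_zero k hs) _ _,
    fun κ _ b b' h => ?_⟩
  have h1 := TubeS.sum_epsilonIsotypic k hs (s S) b b' h
  exact ⟨fun I J => TubeS.gamma_eq_sum k hs h1 _ _, fun A B =>
    ⟨TubeS.epsilonTensor_idem k hs _ _, TubeS.isIsotypicProjection_epsilonIsotypic k hs h1 A B
      (b A B).linearIndependent _⟩⟩
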